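/- Let $G$ be a compact Lie group of dimension $n$, and let $\mathcal L_G=\sum_i X_i^2$ be its Laplacian, where $X_1,\dots,X_n$ is a basis of the Lie algebra (viewed as left-invariant vector fields) that is orthonormal for an $\mathrm{Ad}(G)$-invariant inner product. Let $\widehat G$ be the unitary dual of $G$. For $[\xi]\in\widehat G$ let $d_\xi$ be the dimension of $\xi$ and $\langle\xi\rangle$ the eigenvalue of $(I-\mathcal L_G)^{1/2}$ on the matrix coefficients of $\xi$. For a distribution $f\in\mathcal D'(G)$ let $\widehat f(\xi)=\int_G f(x)\,\xi(x)^*\,dx\in\mathbb C^{d_\xi\times d_\xi}$ (in the sense of distributions), and let $\|A\|_{\mathtt{HS}}=\mathrm{Tr}(AA^*)^{1/2}$. For $0<r<\infty$ and $0<\beta\le\infty$ put $$A_r^{*,\beta}=\Big\{f\in\mathcal D'(G):\ \|f\|_{A_r^{*,\beta}}:=\Big(\sum_{s=0}^\infty\Big(2^{rns}\sup_{2^s\le\langle\xi\rangle}d_\xi^{-1/2}\|\widehat f(\xi)\|_{\mathtt{HS}}\Big)^\beta\Big)^{1/\beta}<\infty\Big\}$$ (with the supremum over $s$ if $\beta=\infty$;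 the inner supremum is $0$ if no $[\xi]$ satisfies $2^s\le\langle\xi\rangle$), and for $0<\beta<\infty$ put $$A^{*,\beta}=\Big\{f\in\mathcal D'(G):\ \|f\|_{A^{*,\beta}}:=\Big(\sum_{s=0}^\infty 2^{ns}\Big(\sup_{2^s\le\langle\xi\rangle}d_\xi^{-1/2}\|\widehat f(\xi)\|_{\mathtt{HS}}\Big)^\beta\Big)^{1/\beta}<\infty\Big\}.$$ For (quasi-)normed spaces $A_0,A_1\subset\mathcal D'(G)$, $0<\theta<1$ and $0<q\le\infty$, let $(A_0,A_1)_{\theta,q}$ be the real interpolation space of all $f\in A_0+A_1$ with $\|f\|_{\theta,q}:=\big(\int_0^\infty(t^{-\theta}K(t,f))^q\,\frac{dt}{t}\big)^{1/q}<\infty$ (with $\sup_{t>0}t^{-\theta}K(t,f)$ if $q=\infty$), where $K(t,f)=\inf\{\|f_0\|_{A_0}+t\|f_1\|_{A_1}:\ f=f_0+f_1,\ f_i\in A_i\}$. Let $0<r_1<r_0<\infty$, $0<\beta_0,\beta_1,q\le\infty$, $0<\theta<1$ and $r=(1-\theta)r_0+\theta r_1$. Then $$(A_{r_0}^{*,\beta_0},A_{r_1}^{*,\beta_1})_{\theta,q}=A_r^{*,q},$$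 and in particular $$(A^{*,1/r_0},A^{*,1/r_1})_{\theta,1/r}=A^{*,1/r},$$ where both equalities are equalities of sets with equivalence of the (quasi-)norms. -/

import Mathlib

open scoped Manifold ContDiff ENNReal NNReal

noncomputable section

namespace BeurlingLie

/-! ### Generalities: `ℓ^q` quasi-norms and the real interpolation method -/

/-- The `ℓ^q(ℕ)` (quasi-)norm of a sequence in `[0, ∞]`, for `0 < q ≤ ∞`. -/
def lqNorm (q : ℝ≥0∞) (a : ℕ → ℝ≥0∞) : ℝ≥0∞ :=
  if q = ⊤ then ⨆ s, a s else (∑' s, a s ^ q.toReal) ^ (1 / q.toReal)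

section RealInterpolation

variable {V : Type*} [AddCommGroup V]

/-- The `K`-functional `K(t, f) = inf {‖f₀‖₀ + t ‖f₁‖₁ : f = f₀ + f₁}` of the couple of spaces
`A_i = {f ∈ V : N_i f < ∞}`, each (quasi-)norm being extended by `∞` off its space. -/
def kFunctional (N₀ N₁ : V → ℝ≥0∞) (t : ℝ) (f : V) : ℝ≥0∞ :=
  ⨅ (f₀ : V) (f₁ : V) (_ : f₀ + f₁ = f), N₀ f₀ + ENNReal.ofReal t * N₁ f₁

/-- The (quasi-)norm of `(A₀, A₁)_{θ, q}`: `(∫₀^∞ (t^{-θ} K(t, f))^q dt/t)^{1/q}` for `q < ∞`,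
and `sup_{t > 0} t^{-θ} K(t, f)` for `q = ∞`. -/
def interpNorm (N₀ N₁ : V → ℝ≥0∞) (θ : ℝ) (q : ℝ≥0∞) (f : V) : ℝ≥0∞ :=
  if q = ⊤ then
    ⨆ (t : ℝ) (_ : 0 < t), ENNReal.ofReal (t ^ (-θ)) * kFunctional N₀ N₁ t f
  else
    (∫⁻ t in Set.Ioi (0 : ℝ),
      (ENNReal.ofReal (t ^ (-θ)) * kFunctional N₀ N₁ t f) ^ q.toReal * ENNReal.ofReal (1 / t))
        ^ (1 / q.toReal)

/-- The set of `f` for which an extended (quasi-)norm is finite. -/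
def finiteSet (N : V → ℝ≥0∞) : Set V := {f | N f < ⊤}

/-- The real interpolation space `(A₀, A₁)_{θ, q}`, as a subset of `A₀ + A₁`. -/
def interpSpace (N₀ N₁ : V → ℝ≥0∞) (θ : ℝ) (q : ℝ≥0∞) : Set V :=
  {f | (∃ f₀ ∈ finiteSet N₀, ∃ f₁ ∈ finiteSet N₁, f₀ + f₁ = f) ∧ interpNorm N₀ N₁ θ q f < ⊤}

/-- Two extended (quasi-)norms are equivalent. -/
def EquivalentNorms (N N' : V → ℝ≥0∞) : Prop :=
  ∃ C : ℝ≥0, 0 < C ∧ ∀ f, N f ≤ C * N' f ∧ N' f ≤ C * N f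

end RealInterpolation

/-! ### Left-invariant differential operators and the Laplacian -/

section LieGroup

variable {n : ℕ} {G : Type*} [Group G] [TopologicalSpace G]
  [ChartedSpace (EuclideanSpace ℝ (Fin n)) G]

/-- The derivative of `φ` along the left-invariant vector field with value `v` at the identity. -/
def leftDeriv (v : GroupLieAlgebra (𝓡 n) G) (φ : G → ℂ) (x : G) : ℂ :=
  mfderiv (𝓡 n) 𝓘(ℝ, ℂ) φ x (mulInvariantVectorField v x)

/-- The left-invariant differential operator `v₁ v₂ ⋯ v_k` applied to `φ`. -/
def iterLeftDeriv (w : List (GroupLieAlgebra (𝓡 n) G)) (φ : G → ℂ) : G → ℂ :=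
  w.foldr leftDeriv φ

/-- The adjoint action of `G` on its Lie algebra: the derivative at `1` of `x ↦ g x g⁻¹`. -/
def adjointAction (g : G) (v : GroupLieAlgebra (𝓡 n) G) : GroupLieAlgebra (𝓡 n) G :=
  mfderiv (𝓡 n) (𝓡 n) (fun x : G => g * x * g⁻¹) 1 v

variable (n G) in
/-- An inner product on the Lie algebra which is invariant under the adjoint action; these are in
bijection with the bi-invariant Riemannian metrics on `G`. -/
structure InvariantInnerProduct where
  /-- the underlying bilinear form -/
  form : LinearMap.BilinForm ℝ (GroupLieAlgebra (𝓡 n) G)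
  symm : ∀ v w, form v w = form w v
  pos : ∀ v, v ≠ 0 → 0 < form v v
  invariant : ∀ (g : G) (v w), form (adjointAction g v) (adjointAction g w) = form v w

/-- `X` is an orthonormal basis of the Lie algebra for the given invariant inner product. -/
def InvariantInnerProduct.IsOrthonormalBasis (B : InvariantInnerProduct n G)
    (X : Module.Basis (Fin n) ℝ (GroupLieAlgebra (𝓡 n) G)) : Prop :=
  ∀ i j, B.form (X i) (X j) = if i = j then 1 else 0

/-- The Laplacian `∑ᵢ Xᵢ²`, for an orthonormal basis `X` of the Lie algebra with respect to an
invariant inner product. It is the (nonpositive) Laplace–Beltrami operator of the corresponding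
bi-invariant metric, and does not depend on the choice of the orthonormal basis. -/
def laplacian (X : Module.Basis (Fin n) ℝ (GroupLieAlgebra (𝓡 n) G)) (φ : G → ℂ) (x : G) : ℂ :=
  ∑ i, leftDeriv (X i) (leftDeriv (X i) φ) x

/-! ### Distributions -/

variable (n G) in
/-- `C^∞(G)`, as a space of complex-valued functions. -/
def smoothFunctions : Submodule ℂ (G → ℂ) where
  carrier := {φ | ContMDiff (𝓡 n) 𝓘(ℝ, ℂ) ∞ φ}
  add_mem' h₁ h₂ := ContMDiff.add h₁ h₂
  zero_mem' := contMDiff_const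
  smul_mem' c φ h := by
    have h1 : ContMDiff 𝓘(ℝ, ℂ) 𝓘(ℝ, ℂ) ∞ (c • ContinuousLinearMap.id ℝ ℂ : ℂ →L[ℝ] ℂ) :=
      ContinuousLinearMap.contMDiff _
    exact h1.comp (show ContMDiff (𝓡 n) 𝓘(ℝ, ℂ) ∞ φ from h)

variable (n G) in
/-- `𝒟'(G)`: the linear functionals on `C^∞(G)` that are continuous for its usual topology, i.e.
the one given by the seminorms `φ ↦ sup_G |v₁ ⋯ v_k φ|`, with `v₁, …, v_k` left-invariant
vector fields. -/
def distributions : Submodule ℂ (smoothFunctions n G →ₗ[ℂ] ℂ) where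
  carrier := {u | ∃ (S : Finset (List (GroupLieAlgebra (𝓡 n) G))) (C : ℝ≥0),
    ∀ (φ : smoothFunctions n G) (M : ℝ), 0 ≤ M →
      (∀ w ∈ S, ∀ x, ‖iterLeftDeriv w φ.1 x‖ ≤ M) → ‖u φ‖ ≤ C * M}
  add_mem' := by
    classical
    rintro u v ⟨S, C, hu⟩ ⟨T, D, hv⟩
    refine ⟨S ∪ T, C + D, fun φ M hM h => ?_⟩
    have h1 := hu φ M hM fun w hw => h w (Finset.mem_union_left _ hw)
    have h2 := hv φ M hM fun w hw => h w (Finset.mem_union_right _ hw)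
    calc ‖(u + v) φ‖ ≤ ‖u φ‖ + ‖v φ‖ := norm_add_le _ _
      _ ≤ ((C + D : ℝ≥0) : ℝ) * M := by push_cast; linarith
  zero_mem' := ⟨∅, 0, fun φ M _ _ => by simp⟩
  smul_mem' := by
    rintro c u ⟨S, C, hu⟩
    refine ⟨S, ‖c‖₊ * C, fun φ M hM h => ?_⟩
    have h1 := mul_le_mul_of_nonneg_left (hu φ M hM h) (norm_nonneg c)
    simpa [mul_assoc] using h1

/-! ### The unitary dual and Fourier coefficients -/

variable (n G) in
/-- An irreducible unitary matrix representation of the Lie group `G`. (Finite-dimensional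
continuous representations of a Lie group are automatically smooth, and irreducible unitary
representations of a compact group are automatically finite-dimensional.) -/
structure UnitaryIrrep where
  /-- the dimension `d_ξ` -/
  dim : ℕ
  /-- the matrix-valued homomorphism `x ↦ ξ(x)` -/
  toHom : G →* Matrix (Fin dim) (Fin dim) ℂ
  unitary : ∀ x, toHom x ∈ Matrix.unitaryGroup (Fin dim) ℂ
  smooth : ∀ i j, ContMDiff (𝓡 n) 𝓘(ℝ, ℂ) ∞ fun x => toHom x i j
  irreducible : Representation.IsIrreducible
    (((Matrix.toLinAlgEquiv' : Matrix (Fin dim) (Fin dim) ℂ ≃ₐ[ℂ] _) :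
      Matrix (Fin dim) (Fin dim) ℂ →* Module.End ℂ (Fin dim → ℂ)).comp toHom :
        Representation ℂ G (Fin dim → ℂ))

/-- Unitary equivalence of representations. -/
def UnitaryIrrep.Equivalent (ξ η : UnitaryIrrep n G) : Prop :=
  ∃ U : Matrix (Fin η.dim) (Fin ξ.dim) ℂ,
    U.conjTranspose * U = 1 ∧ U * U.conjTranspose = 1 ∧ ∀ x, U * ξ.toHom x = η.toHom x * U

variable (n G) in
/-- The setoid of unitary equivalence. -/
def irrepSetoid : Setoid (UnitaryIrrep n G) where
  r := UnitaryIrrep.Equivalent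
  iseqv :=
    { refl := fun ξ => ⟨1, by simp, by simp, by simp⟩
      symm := by
        rintro ξ η ⟨U, h1, h2, h3⟩
        refine ⟨U.conjTranspose, by simpa using h2, by simpa using h1, fun x => ?_⟩
        calc U.conjTranspose * η.toHom x
            = U.conjTranspose * (η.toHom x * U) * U.conjTranspose := by
              rw [Matrix.mul_assoc, Matrix.mul_assoc, h2, Matrix.mul_one]
          _ = (U.conjTranspose * U) * ξ.toHom x * U.conjTranspose := by
              rw [← h3 x]; simp only [Matrix.mul_assoc]
          _ = ξ.toHom x * U.conjTranspose := by rw [h1, Matrix.one_mul]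
      trans := by
        rintro ξ η ζ ⟨U, h1, h2, h3⟩ ⟨W, k1, k2, k3⟩
        refine ⟨W * U, ?_, ?_, fun x => ?_⟩
        · rw [Matrix.conjTranspose_mul, Matrix.mul_assoc,
            ← Matrix.mul_assoc W.conjTranspose W U, k1, Matrix.one_mul, h1]
        · rw [Matrix.conjTranspose_mul, Matrix.mul_assoc,
            ← Matrix.mul_assoc U U.conjTranspose, h2, Matrix.one_mul, k2]
        · rw [Matrix.mul_assoc, h3 x, ← Matrix.mul_assoc, k3 x, Matrix.mul_assoc] }

variable (n G) in
/-- The unitary dual of `G`: equivalence classes `[ξ]` of irreducible unitary representations. -/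
def UnitaryDual : Type _ := Quotient (irrepSetoid n G)

/-- A fixed matrix representation `ξ` in the class `[ξ]`. -/
def UnitaryDual.rep (ξ : UnitaryDual n G) : UnitaryIrrep n G := Quotient.out ξ

/-- `⟨ξ⟩`: the eigenvalue of `(1 - Δ)^{1/2}` on the matrix coefficients of `ξ`, that is the number
`μ ≥ 0` with `(1 - Δ) ξ_{ij} = μ² ξ_{ij}` for all `i, j` (it exists, and is unique). -/
def UnitaryIrrep.bracket (X : Module.Basis (Fin n) ℝ (GroupLieAlgebra (𝓡 n) G))
    (ξ : UnitaryIrrep n G) : ℝ :=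
  Classical.epsilon fun μ : ℝ => 0 ≤ μ ∧ ∀ i j x,
    ξ.toHom x i j - laplacian X (fun y => ξ.toHom y i j) x = (μ : ℂ) ^ 2 * ξ.toHom x i j

/-- The entry `(i, j)` of `x ↦ ξ(x)^*`, as a test function. -/
def UnitaryIrrep.adjointEntry (ξ : UnitaryIrrep n G) (i j : Fin ξ.dim) : smoothFunctions n G :=
  ⟨fun x => (ξ.toHom x).conjTranspose i j,
    ContMDiff.comp (I' := 𝓘(ℝ, ℂ)) (ContinuousLinearMap.contMDiff (Complex.conjCLE : ℂ →L[ℝ] ℂ))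
      (ξ.smooth j i)⟩

/-- The Fourier coefficient `∫_G f(x) ξ(x)^* dx` of a distribution `f`, i.e. the matrix with
entries `⟨f, (ξ^*)_{ij}⟩`. -/
def groupFourierCoeff (f : distributions n G) (ξ : UnitaryIrrep n G) :
    Matrix (Fin ξ.dim) (Fin ξ.dim) ℂ :=
  Matrix.of fun i j => f.1 (ξ.adjointEntry i j)

/-- The Hilbert–Schmidt norm `Tr(A A^*)^{1/2}`. -/
def hsNorm {d : ℕ} (A : Matrix (Fin d) (Fin d) ℂ) : ℝ :=
  √(Matrix.trace (A * A.conjTranspose)).re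

/-! ### Beurling-type spaces -/

/-- `sup_{2^s ≤ ⟨ξ⟩} d_ξ^{-1/2} ‖f̂(ξ)‖_HS`, the supremum running over classes `[ξ]`. -/
def tailSup (X : Module.Basis (Fin n) ℝ (GroupLieAlgebra (𝓡 n) G)) (f : distributions n G)
    (s : ℕ) : ℝ≥0∞ :=
  ⨆ (ξ : UnitaryDual n G) (_ : (2 : ℝ) ^ s ≤ ξ.rep.bracket X),
    ENNReal.ofReal ((ξ.rep.dim : ℝ) ^ (-(1 / 2) : ℝ) * hsNorm (groupFourierCoeff f ξ.rep))

/-- The (quasi-)norm of `A_r^{*,β}`, for `0 < β ≤ ∞`: the `ℓ^β` (quasi-)norm of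
`2^{rns} sup_{2^s ≤ ⟨ξ⟩} d_ξ^{-1/2} ‖f̂(ξ)‖_HS`, `s = 0, 1, 2, …`. -/
def beurlingNorm (X : Module.Basis (Fin n) ℝ (GroupLieAlgebra (𝓡 n) G)) (r : ℝ) (β : ℝ≥0∞)
    (f : distributions n G) : ℝ≥0∞ :=
  lqNorm β fun s => ENNReal.ofReal ((2 : ℝ) ^ (r * n * s)) * tailSup X f s

/-- The (quasi-)norm of `A^{*,β}`, for `0 < β < ∞`:
`(∑_s 2^{ns} (sup_{2^s ≤ ⟨ξ⟩} d_ξ^{-1/2} ‖f̂(ξ)‖_HS)^β)^{1/β}`. -/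
def beurlingStarNorm (X : Module.Basis (Fin n) ℝ (GroupLieAlgebra (𝓡 n) G)) (β : ℝ)
    (f : distributions n G) : ℝ≥0∞ :=
  (∑' s : ℕ, (2 : ℝ≥0∞) ^ (n * s) * tailSup X f s ^ β) ^ (1 / β)

end LieGroup

end BeurlingLie

end

/-! Write `τ f s` for the tail supremum. Real interpolation uses only two of its properties:
subadditivity in `f`, and the existence, at every level `m`, of a splitting of `f` into a part of
frequency below `2^m` and a remainder whose tails are those of `f` frozen below level `m`.

Put `δ = ρ₀ - ρ₁` and `b s = 2^(ρ s) τ f s`. Subadditivity gives `K(t, f) ≥ 2^(ρ₀ s) τ f s = 2^(θ δ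
s) b s` for `t ≥ 2^(δ s)` (`IsTailFunctional.le_kFunctional`). Splitting at level `m` gives `K(t, f)
≤ C 2^(θ δ m) geomMax ε b m` for `t ≤ 2^(δ m)` (`IsTailFunctional.kFunctional_le_geomMax`), and
`geomMax ε` is bounded on every `ℓ^q`. Cutting the half-line at the points `2^(δ s)` then compares
the interpolation norm with `‖b‖_q` in both directions (`IsTailFunctional.interpolation`).

On the group, the low-frequency part must be a distribution. It is a trigonometric polynomial,
because only finitely many classes satisfy `⟨ξ⟩ ≤ R` (`finite_bracket_le`). The Casimir identity
bounds the derivatives of the diagonal coefficients of all such `ξ` uniformly, so on a common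
neighbourhood `V` of the identity they stay within `1/2` of `1`. A sum of `N` characters is thus at
least `N/2` in modulus on `V`, while orthonormality makes its squared `L²` norm equal to `N`; hence
`N ≤ 4/μ(V)`. Neither the Peter–Weyl theorem nor spectral theory enters. -/

noncomputable section

namespace BeurlingLie

open MeasureTheory

/-! ### Sequence quasi-norms and a maximal function with geometric kernel -/

section SequenceNorms

lemma two_rpow_add (x y : ℝ) : (2 : ℝ≥0∞) ^ (x + y) = 2 ^ x * 2 ^ y :=
  ENNReal.rpow_add _ _ (by simp) (by simp)

lemma ofReal_two_rpow (x : ℝ) : ENNReal.ofReal ((2 : ℝ) ^ x) = (2 : ℝ≥0∞) ^ x := by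
  rw [← ENNReal.ofReal_rpow_of_pos two_pos]; simp

lemma two_rpow_le {x y : ℝ} (h : x ≤ y) : (2 : ℝ≥0∞) ^ x ≤ 2 ^ y :=
  ENNReal.rpow_le_rpow_of_exponent_le (by simp) h

lemma lqNorm_top (a : ℕ → ℝ≥0∞) : lqNorm ⊤ a = ⨆ s, a s := if_pos rfl

lemma lqNorm_of_ne_top {q : ℝ≥0∞} (hq : q ≠ ⊤) (a : ℕ → ℝ≥0∞) :
    lqNorm q a = (∑' s, a s ^ q.toReal) ^ (1 / q.toReal) := if_neg hq

lemma lqNorm_mono (q : ℝ≥0∞) {a b : ℕ → ℝ≥0∞} (h : ∀ s, a s ≤ b s) :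
    lqNorm q a ≤ lqNorm q b := by
  unfold lqNorm
  split_ifs
  · exact iSup_mono h
  · exact ENNReal.rpow_le_rpow
      (ENNReal.tsum_le_tsum fun s => ENNReal.rpow_le_rpow (h s) ENNReal.toReal_nonneg)
      (by positivity)

lemma lqNorm_const_mul {q : ℝ≥0∞} (hq : 0 < q) (c : ℝ≥0∞) (a : ℕ → ℝ≥0∞) :
    lqNorm q (fun s => c * a s) = c * lqNorm q a := by
  unfold lqNorm
  split_ifs with h
  · rw [ENNReal.mul_iSup]
  · have hp : 0 < q.toReal := ENNReal.toReal_pos hq.ne' h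
    simp_rw [ENNReal.mul_rpow_of_nonneg _ _ hp.le, ENNReal.tsum_mul_left]
    rw [ENNReal.mul_rpow_of_nonneg _ _ (by positivity), ← ENNReal.rpow_mul,
      mul_one_div_cancel hp.ne', ENNReal.rpow_one]

lemma le_lqNorm {q : ℝ≥0∞} (hq : 0 < q) (a : ℕ → ℝ≥0∞) (s : ℕ) : a s ≤ lqNorm q a := by
  unfold lqNorm
  split_ifs with h
  · exact le_iSup a s
  · have hp : 0 < q.toReal := ENNReal.toReal_pos hq.ne' h
    calc a s = (a s ^ q.toReal) ^ (1 / q.toReal) := by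
          rw [← ENNReal.rpow_mul, mul_one_div_cancel hp.ne', ENNReal.rpow_one]
      _ ≤ _ := ENNReal.rpow_le_rpow (ENNReal.le_tsum s) (by positivity)

lemma tsum_int_two_rpow_ne_top {ε : ℝ} (hε : 0 < ε) :
    ∑' z : ℤ, (2 : ℝ≥0∞) ^ (-ε * |(z : ℝ)|) ≠ ⊤ := by
  have h1 : Summable fun k : ℕ => (2 : ℝ) ^ (-ε * (k : ℝ)) := by
    simp_rw [Real.rpow_mul two_pos.le, Real.rpow_natCast]
    exact summable_geometric_of_lt_one (by positivity)
      (Real.rpow_lt_one_of_one_lt_of_neg one_lt_two (by linarith))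
  have h2 : Summable fun z : ℤ => (2 : ℝ) ^ (-ε * |(z : ℝ)|) :=
    Summable.of_nat_of_neg (by simpa using h1) (by simpa using h1)
  simp_rw [← ofReal_two_rpow]
  exact h2.tsum_ofReal_ne_top

lemma tsum_two_rpow_dist_le (ε : ℝ) (m : ℕ) :
    ∑' j : ℕ, (2 : ℝ≥0∞) ^ (-ε * |(m : ℝ) - j|) ≤ ∑' z : ℤ, (2 : ℝ≥0∞) ^ (-ε * |(z : ℝ)|) := by
  have h : Function.Injective fun j : ℕ => (m : ℤ) - j := fun a b hab => by
    simpa using hab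
  simpa using ENNReal.tsum_comp_le_tsum_of_injective h
    (fun z : ℤ => (2 : ℝ≥0∞) ^ (-ε * |(z : ℝ)|))

/-- Both pieces of the splitting at level `m` will be dominated by a multiple of this kernel centred
at `m`, so the exponents `β₀`, `β₁` enter only through the constant `C`. -/
lemma lqNorm_two_rpow_dist_le {ε : ℝ} (hε : 0 < ε) {q : ℝ≥0∞} (hq : 0 < q) :
    ∃ C : ℝ≥0, ∀ m : ℕ, lqNorm q (fun j : ℕ => 2 ^ (-ε * |(m : ℝ) - j|)) ≤ C := by
  by_cases h : q = ⊤
  · refine ⟨1, fun m => ?_⟩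
    rw [h, lqNorm_top]
    refine iSup_le fun j => ?_
    calc (2 : ℝ≥0∞) ^ (-ε * |(m : ℝ) - j|) ≤ 2 ^ (0 : ℝ) := two_rpow_le (by
          have := mul_nonneg hε.le (abs_nonneg ((m : ℝ) - j)); linarith)
      _ = _ := by simp
  · have hp : 0 < q.toReal := ENNReal.toReal_pos hq.ne' h
    refine ⟨((∑' z : ℤ, (2 : ℝ≥0∞) ^ (-(ε * q.toReal) * |(z : ℝ)|)) ^ (1 / q.toReal)).toNNReal,
      fun m => ?_⟩
    rw [ENNReal.coe_toNNReal (ENNReal.rpow_ne_top_of_nonneg (by positivity)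
      (tsum_int_two_rpow_ne_top (by positivity))), lqNorm_of_ne_top h]
    refine ENNReal.rpow_le_rpow ?_ (by positivity)
    refine le_trans (le_of_eq ?_) (tsum_two_rpow_dist_le (ε * q.toReal) m)
    refine tsum_congr fun j => ?_
    rw [← ENNReal.rpow_mul]; congr 1; ring

/-- The maximal function of a sequence with respect to a geometrically decaying kernel. -/
def geomMax (ε : ℝ) (b : ℕ → ℝ≥0∞) (m : ℕ) : ℝ≥0∞ :=
  ⨆ j : ℕ, 2 ^ (-ε * |(m : ℝ) - j|) * b j

/-- For finite `q` the `q`-th power of a supremum is at most the sum of the `q`-th powers, and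
exchanging the two sums finishes. No triangle inequality is used, so `q < 1` is covered. -/
lemma lqNorm_geomMax_le {ε : ℝ} (hε : 0 < ε) {q : ℝ≥0∞} (hq : 0 < q) :
    ∃ C : ℝ≥0, ∀ b : ℕ → ℝ≥0∞, lqNorm q (geomMax ε b) ≤ C * lqNorm q b := by
  by_cases h : q = ⊤
  · refine ⟨1, fun b => ?_⟩
    rw [h, lqNorm_top, lqNorm_top, ENNReal.coe_one, one_mul]
    refine iSup_le fun m => iSup_le fun j => le_trans ?_ (le_iSup b j)
    refine mul_le_of_le_one_left (zero_le) ?_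
    calc (2 : ℝ≥0∞) ^ (-ε * |(m : ℝ) - j|) ≤ 2 ^ (0 : ℝ) := two_rpow_le (by
          have := mul_nonneg hε.le (abs_nonneg ((m : ℝ) - j)); linarith)
      _ = _ := by simp
  · have hp : 0 < q.toReal := ENNReal.toReal_pos hq.ne' h
    set S := ∑' z : ℤ, (2 : ℝ≥0∞) ^ (-(ε * q.toReal) * |(z : ℝ)|) with hS
    have hSt : S ≠ ⊤ := tsum_int_two_rpow_ne_top (by positivity)
    refine ⟨(S ^ (1 / q.toReal)).toNNReal, fun b => ?_⟩
    rw [ENNReal.coe_toNNReal (ENNReal.rpow_ne_top_of_nonneg (by positivity) hSt),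
      lqNorm_of_ne_top h, lqNorm_of_ne_top h, ← ENNReal.mul_rpow_of_nonneg _ _ (by positivity)]
    refine ENNReal.rpow_le_rpow ?_ (by positivity)
    have h1 : ∀ m, geomMax ε b m ^ q.toReal ≤
        ∑' j : ℕ, 2 ^ (-(ε * q.toReal) * |(m : ℝ) - j|) * b j ^ q.toReal := by
      intro m
      rw [← ENNReal.le_rpow_inv_iff hp]
      refine iSup_le fun j => ?_
      rw [ENNReal.le_rpow_inv_iff hp, ENNReal.mul_rpow_of_nonneg _ _ hp.le, ← ENNReal.rpow_mul]
      refine le_trans (le_of_eq ?_) (ENNReal.le_tsum j)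
      congr 2; ring
    calc ∑' m, geomMax ε b m ^ q.toReal
        ≤ ∑' (m : ℕ) (j : ℕ), 2 ^ (-(ε * q.toReal) * |(m : ℝ) - j|) * b j ^ q.toReal :=
          ENNReal.tsum_le_tsum h1
      _ = ∑' (j : ℕ) (m : ℕ), 2 ^ (-(ε * q.toReal) * |(m : ℝ) - j|) * b j ^ q.toReal :=
          ENNReal.tsum_comm
      _ ≤ ∑' j : ℕ, S * b j ^ q.toReal := by
          refine ENNReal.tsum_le_tsum fun j => ?_
          rw [ENNReal.tsum_mul_right]
          gcongr
          simp_rw [abs_sub_comm _ (j : ℝ)]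
          exact tsum_two_rpow_dist_le _ j
      _ = _ := ENNReal.tsum_mul_left

end SequenceNorms

/-! ### Discretization of the interpolation functional -/

section Discretization

/-- The functional `k ↦ ‖t^{-θ} k(t)‖_{L^q(dt/t)}` of the real interpolation method. -/
def weightedLqNorm (θ : ℝ) (q : ℝ≥0∞) (k : ℝ → ℝ≥0∞) : ℝ≥0∞ :=
  if q = ⊤ then
    ⨆ (t : ℝ) (_ : 0 < t), ENNReal.ofReal (t ^ (-θ)) * k t
  else
    (∫⁻ t in Set.Ioi (0 : ℝ),
      (ENNReal.ofReal (t ^ (-θ)) * k t) ^ q.toReal * ENNReal.ofReal (1 / t)) ^ (1 / q.toReal)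

/-- The intervals `(2^{δs}, 2^{δ(s+1)}]`. -/
def dyadicIoc (δ : ℝ) (s : ℕ) : Set ℝ := Set.Ioc (2 ^ (δ * s)) (2 ^ (δ * (s + 1)))

lemma two_rpow_strictMono {δ : ℝ} (hδ : 0 < δ) : StrictMono fun s : ℕ => (2 : ℝ) ^ (δ * s) :=
  fun a b h => Real.rpow_lt_rpow_of_exponent_lt one_lt_two
    (mul_lt_mul_of_pos_left (by exact_mod_cast h) hδ)

lemma pairwise_disjoint_dyadicIoc {δ : ℝ} (hδ : 0 < δ) :
    Pairwise (Function.onFun Disjoint (dyadicIoc δ)) := by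
  have := (two_rpow_strictMono hδ).monotone.pairwise_disjoint_on_Ioc_succ
  intro a b hab
  simpa [Function.onFun, dyadicIoc] using this hab

lemma Ioi_subset_dyadicIoc {δ : ℝ} (hδ : 0 < δ) :
    Set.Ioi (0 : ℝ) ⊆ Set.Ioc 0 1 ∪ ⋃ s, dyadicIoc δ s := by
  intro t ht
  by_cases h1 : t ≤ 1
  · exact Or.inl ⟨ht, h1⟩
  · push Not at h1
    right
    have hex : ∃ m : ℕ, t ≤ 2 ^ (δ * m) := by
      have hb : 1 < (2 : ℝ) ^ δ := Real.one_lt_rpow one_lt_two hδ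
      obtain ⟨m, hm⟩ := pow_unbounded_of_one_lt t hb
      refine ⟨m, ?_⟩
      rw [Real.rpow_mul two_pos.le, Real.rpow_natCast]
      exact hm.le
    classical
    have h0 : Nat.find hex ≠ 0 := by
      intro h
      have := Nat.find_spec hex
      rw [h] at this
      simp at this
      linarith
    obtain ⟨s, hs⟩ := Nat.exists_eq_succ_of_ne_zero h0
    refine Set.mem_iUnion.2 ⟨s, ?_, ?_⟩
    · have := Nat.find_min hex (m := s) (by omega)
      exact not_le.1 this
    · have := Nat.find_spec hex
      rw [hs] at this
      simpa using this

lemma volume_dyadicIoc (δ : ℝ) (s : ℕ) :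
    volume (dyadicIoc δ s) = 2 ^ (δ * (s + 1)) * ENNReal.ofReal (1 - 2 ^ (-δ)) := by
  rw [dyadicIoc, Real.volume_Ioc, ← ofReal_two_rpow, ← ENNReal.ofReal_mul (by positivity)]
  congr 1
  rw [mul_sub, ← Real.rpow_add two_pos]
  ring_nf

lemma ofReal_rpow_le_two_rpow {θ t x : ℝ} (hθ : 0 < θ) (h : (2 : ℝ) ^ x ≤ t) :
    ENNReal.ofReal (t ^ (-θ)) ≤ 2 ^ (-(θ * x)) := by
  rw [← ofReal_two_rpow]
  refine ENNReal.ofReal_le_ofReal ?_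
  calc t ^ (-θ) ≤ ((2 : ℝ) ^ x) ^ (-θ) :=
        Real.rpow_le_rpow_of_nonpos (by positivity) h (by linarith)
    _ = _ := by rw [← Real.rpow_mul two_pos.le]; ring_nf

lemma two_rpow_le_ofReal_rpow {θ t x : ℝ} (hθ : 0 < θ) (ht : 0 < t) (h : t ≤ (2 : ℝ) ^ x) :
    2 ^ (-(θ * x)) ≤ ENNReal.ofReal (t ^ (-θ)) := by
  rw [← ofReal_two_rpow]
  refine ENNReal.ofReal_le_ofReal ?_
  calc _ = ((2 : ℝ) ^ x) ^ (-θ) := by rw [← Real.rpow_mul two_pos.le]; ring_nf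
    _ ≤ _ := Real.rpow_le_rpow_of_nonpos ht h (by linarith)

/-- On each dyadic interval `t^(-θ)` and `1/t` are comparable to constants. The intervals are
disjoint, and those beyond `1` already see every index `s ≥ 0`. -/
lemma lqNorm_le_weightedLqNorm {θ δ : ℝ} (hθ : 0 < θ) (hδ : 0 < δ) {q : ℝ≥0∞} (hq : 0 < q) :
    ∃ C : ℝ≥0, ∀ (b : ℕ → ℝ≥0∞) (k : ℝ → ℝ≥0∞),
      (∀ (s : ℕ) (t : ℝ), 2 ^ (δ * s) ≤ t → 2 ^ (θ * (δ * s)) * b s ≤ k t) →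
      lqNorm q b ≤ C * weightedLqNorm θ q k := by
  by_cases h : q = ⊤
  · refine ⟨1, fun b k hk => ?_⟩
    rw [h, lqNorm_top, weightedLqNorm, if_pos rfl, ENNReal.coe_one, one_mul]
    refine iSup_le fun s => le_trans ?_ (le_iSup₂ ((2 : ℝ) ^ (δ * s)) (by positivity))
    calc b s = 2 ^ (-(θ * (δ * s))) * (2 ^ (θ * (δ * s)) * b s) := by
          rw [← mul_assoc, ← two_rpow_add]; simp
      _ ≤ _ := by
          gcongr
          · exact two_rpow_le_ofReal_rpow hθ (by positivity) le_rfl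
          · exact hk s _ le_rfl
  · have hp : 0 < q.toReal := ENNReal.toReal_pos hq.ne' h
    -- The first factor is the loss from evaluating `t^(-θ)` at the right endpoint; the second is
    -- the interval's length divided by that endpoint, a lower bound for its `dt/t` measure.
    set c : ℝ≥0∞ := (2 ^ (-(θ * δ))) ^ q.toReal * ENNReal.ofReal (1 - 2 ^ (-δ)) with hc
    have hlt : (2 : ℝ) ^ (-δ) < 1 :=
      Real.rpow_lt_one_of_one_lt_of_neg one_lt_two (by linarith)
    have hc0 : c ≠ 0 := by
      refine mul_ne_zero (by simp) ?_
      rw [Ne, ENNReal.ofReal_eq_zero]; linarith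
    have hct : c ≠ ⊤ := ENNReal.mul_ne_top (by simp) ENNReal.ofReal_ne_top
    refine ⟨(c⁻¹ ^ (1 / q.toReal)).toNNReal, fun b k hk => ?_⟩
    rw [ENNReal.coe_toNNReal (ENNReal.rpow_ne_top_of_nonneg (by positivity)
      (ENNReal.inv_ne_top.2 hc0)), lqNorm_of_ne_top h, weightedLqNorm, if_neg h,
      ← ENNReal.mul_rpow_of_nonneg _ _ (by positivity)]
    refine ENNReal.rpow_le_rpow ?_ (by positivity)
    rw [← ENNReal.mul_le_iff_le_inv hc0 hct]
    have hpos : ∀ s : ℕ, (0 : ℝ) < 2 ^ (δ * s) := fun s => by positivity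
    set F : ℝ → ℝ≥0∞ := fun t =>
      (ENNReal.ofReal (t ^ (-θ)) * k t) ^ q.toReal * ENNReal.ofReal (1 / t) with hF
    have hs : ∀ s, c * b s ^ q.toReal ≤ ∫⁻ t in dyadicIoc δ s, F t := by
      intro s
      calc c * b s ^ q.toReal
          = (2 ^ (-(θ * δ)) * b s) ^ q.toReal * 2 ^ (-(δ * (s + 1)))
              * volume (dyadicIoc δ s) := by
            rw [volume_dyadicIoc, hc, ENNReal.mul_rpow_of_nonneg _ _ hp.le]
            have : (2 : ℝ≥0∞) ^ (-(δ * (s + 1))) * 2 ^ (δ * (s + 1)) = 1 := by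
              rw [← two_rpow_add]; simp
            calc _ = (2 ^ (-(θ * δ))) ^ q.toReal * ENNReal.ofReal (1 - 2 ^ (-δ)) *
                  b s ^ q.toReal * 1 := by rw [mul_one]
              _ = _ := by rw [← this]; ring
        _ = ∫⁻ t in dyadicIoc δ s, (2 ^ (-(θ * δ)) * b s) ^ q.toReal * 2 ^ (-(δ * (s + 1))) := by
            rw [setLIntegral_const]
        _ ≤ _ := by
            refine setLIntegral_mono' measurableSet_Ioc fun t ht => ?_
            have ht0 : 0 < t := (hpos s).trans ht.1
            refine mul_le_mul' (ENNReal.rpow_le_rpow ?_ hp.le) ?_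
            · calc 2 ^ (-(θ * δ)) * b s
                  = 2 ^ (-(θ * (δ * (s + 1)))) * (2 ^ (θ * (δ * s)) * b s) := by
                    rw [← mul_assoc, ← two_rpow_add]; ring_nf
                _ ≤ _ := by
                    gcongr
                    · exact two_rpow_le_ofReal_rpow hθ ht0 ht.2
                    · exact hk s t ht.1.le
            · rw [← ofReal_two_rpow, Real.rpow_neg two_pos.le, one_div]
              exact ENNReal.ofReal_le_ofReal (inv_anti₀ ht0 ht.2)
    calc c * ∑' s, b s ^ q.toReal = ∑' s, c * b s ^ q.toReal := ENNReal.tsum_mul_left.symm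
      _ ≤ ∑' s, ∫⁻ t in dyadicIoc δ s, F t := ENNReal.tsum_le_tsum hs
      _ = ∫⁻ t in ⋃ s, dyadicIoc δ s, F t :=
          (lintegral_iUnion (fun s => measurableSet_Ioc) (pairwise_disjoint_dyadicIoc hδ) F).symm
      _ ≤ _ := lintegral_mono_set (Set.iUnion_subset fun s t ht => (hpos s).trans ht.1)

/-- The levels `s ≥ 0` say nothing useful as `t → 0`; there the bound `k t ≤ t e 0` takes over, and
`t^(1-θ)` is integrable against `dt/t` on `(0, 1]`. On a dyadic interval `k` is controlled from its
right endpoint, hence the index `s + 1`. -/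
lemma weightedLqNorm_le_lqNorm {θ δ : ℝ} (hθ : 0 < θ) (hθ1 : θ < 1) (hδ : 0 < δ)
    {q : ℝ≥0∞} (hq : 0 < q) :
    ∃ C : ℝ≥0, ∀ (e : ℕ → ℝ≥0∞) (k : ℝ → ℝ≥0∞),
      (∀ (s : ℕ) (t : ℝ), 0 < t → t ≤ 2 ^ (δ * s) → k t ≤ 2 ^ (θ * (δ * s)) * e s) →
      (∀ t : ℝ, 0 < t → t ≤ 1 → k t ≤ ENNReal.ofReal t * e 0) →
      weightedLqNorm θ q k ≤ C * lqNorm q e := by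
  have small : ∀ (e : ℕ → ℝ≥0∞) (k : ℝ → ℝ≥0∞) (t : ℝ), 0 < t →
      k t ≤ ENNReal.ofReal t * e 0 →
      ENNReal.ofReal (t ^ (-θ)) * k t ≤ ENNReal.ofReal (t ^ (1 - θ)) * e 0 := by
    intro e k t ht h
    calc ENNReal.ofReal (t ^ (-θ)) * k t
        ≤ ENNReal.ofReal (t ^ (-θ)) * (ENNReal.ofReal t * e 0) := by gcongr
      _ = _ := by
        rw [← mul_assoc, ← ENNReal.ofReal_mul (by positivity)]
        congr 2
        rw [sub_eq_neg_add, Real.rpow_add ht, Real.rpow_one]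
  have large : ∀ (e : ℕ → ℝ≥0∞) (k : ℝ → ℝ≥0∞),
      (∀ (s : ℕ) (t : ℝ), 0 < t → t ≤ 2 ^ (δ * s) → k t ≤ 2 ^ (θ * (δ * s)) * e s) →
      ∀ s, ∀ t ∈ dyadicIoc δ s, ENNReal.ofReal (t ^ (-θ)) * k t ≤ 2 ^ (θ * δ) * e (s + 1) := by
    intro e k hk s t ht
    have ht0 : 0 < t := lt_trans (by positivity) ht.1
    calc ENNReal.ofReal (t ^ (-θ)) * k t
        ≤ 2 ^ (-(θ * (δ * s))) * (2 ^ (θ * (δ * (s + 1 : ℕ))) * e (s + 1)) := by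
          gcongr
          · exact ofReal_rpow_le_two_rpow hθ ht.1.le
          · exact hk (s + 1) t ht0 (by simpa using ht.2)
      _ = _ := by
          rw [← mul_assoc, ← two_rpow_add]; congr 2; push_cast; ring
  by_cases h : q = ⊤
  · refine ⟨(2 : ℝ≥0) ^ (θ * δ), fun e k hk hk1 => ?_⟩
    rw [h, lqNorm_top, weightedLqNorm, if_pos rfl]
    have hC : ((2 : ℝ≥0) ^ (θ * δ) : ℝ≥0) = (2 : ℝ≥0∞) ^ (θ * δ) := by
      rw [ENNReal.coe_rpow_of_ne_zero (by simp)]; simp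
    rw [hC]
    refine iSup₂_le fun t ht => ?_
    rcases Ioi_subset_dyadicIoc hδ ht with h1 | h1
    · refine (small e k t ht (hk1 t ht h1.2)).trans ?_
      refine mul_le_mul' ?_ (le_iSup e 0)
      calc ENNReal.ofReal (t ^ (1 - θ)) ≤ ENNReal.ofReal 1 :=
            ENNReal.ofReal_le_ofReal (Real.rpow_le_one ht.le h1.2 (by linarith))
        _ = 2 ^ (0 : ℝ) := by simp
        _ ≤ _ := two_rpow_le (by positivity)
    · obtain ⟨s, hs⟩ := Set.mem_iUnion.1 h1
      refine (large e k hk s t hs).trans ?_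
      gcongr
      exact le_iSup e (s + 1)
  · have hp : 0 < q.toReal := ENNReal.toReal_pos hq.ne' h
    set I₀ : ℝ≥0∞ := ∫⁻ t in Set.Ioc (0 : ℝ) 1, ENNReal.ofReal (t ^ ((1 - θ) * q.toReal - 1))
      with hI₀
    have hI₀t : I₀ ≠ ⊤ := by
      have hint : IntervalIntegrable (fun t : ℝ => t ^ ((1 - θ) * q.toReal - 1)) volume 0 1 :=
        intervalIntegral.intervalIntegrable_rpow' (by
          have := mul_pos (sub_pos.2 hθ1) hp; linarith)
      rw [intervalIntegrable_iff_integrableOn_Ioc_of_le zero_le_one] at hint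
      exact hint.lintegral_lt_top.ne
    -- The factor `2^δ` bounds the `dt/t` measure of a dyadic interval crudely by the ratio of its
    -- endpoints.
    set D : ℝ≥0∞ := (2 ^ (θ * δ)) ^ q.toReal * 2 ^ δ with hD
    have hDt : D ≠ ⊤ := ENNReal.mul_ne_top (by simp) (by simp)
    refine ⟨((I₀ + D) ^ (1 / q.toReal)).toNNReal, fun e k hk hk1 => ?_⟩
    rw [ENNReal.coe_toNNReal (ENNReal.rpow_ne_top_of_nonneg (by positivity)
      (ENNReal.add_ne_top.2 ⟨hI₀t, hDt⟩)), lqNorm_of_ne_top h, weightedLqNorm, if_neg h,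
      ← ENNReal.mul_rpow_of_nonneg _ _ (by positivity)]
    refine ENNReal.rpow_le_rpow ?_ (by positivity)
    set F : ℝ → ℝ≥0∞ := fun t =>
      (ENNReal.ofReal (t ^ (-θ)) * k t) ^ q.toReal * ENNReal.ofReal (1 / t) with hF
    have h0 : ∫⁻ t in Set.Ioc (0 : ℝ) 1, F t ≤ I₀ * e 0 ^ q.toReal := by
      rw [hI₀, ← lintegral_mul_const _ (by fun_prop)]
      refine setLIntegral_mono' measurableSet_Ioc fun t ht => ?_
      calc F t ≤ (ENNReal.ofReal (t ^ (1 - θ)) * e 0) ^ q.toReal * ENNReal.ofReal (1 / t) := by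
            refine mul_le_mul_left ?_ _
            exact ENNReal.rpow_le_rpow (small e k t ht.1 (hk1 t ht.1 ht.2)) hp.le
        _ = _ := by
            have : ENNReal.ofReal (t ^ ((1 - θ) * q.toReal - 1)) =
                ENNReal.ofReal (t ^ (1 - θ)) ^ q.toReal * ENNReal.ofReal (1 / t) := by
              rw [ENNReal.ofReal_rpow_of_nonneg (Real.rpow_nonneg ht.1.le _) hp.le,
                ← ENNReal.ofReal_mul (Real.rpow_nonneg (Real.rpow_nonneg ht.1.le _) _),
                ← Real.rpow_mul ht.1.le, Real.rpow_sub ht.1, Real.rpow_one,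
                div_eq_mul_one_div]
            rw [this, ENNReal.mul_rpow_of_nonneg _ _ hp.le]
            ring
    have hs : ∀ s, ∫⁻ t in dyadicIoc δ s, F t ≤ D * e (s + 1) ^ q.toReal := by
      intro s
      calc ∫⁻ t in dyadicIoc δ s, F t
          ≤ ∫⁻ t in dyadicIoc δ s, (2 ^ (θ * δ) * e (s + 1)) ^ q.toReal * 2 ^ (-(δ * s)) := by
            refine setLIntegral_mono' measurableSet_Ioc fun t ht => ?_
            refine mul_le_mul' (ENNReal.rpow_le_rpow (large e k hk s t ht) hp.le) ?_
            rw [← ofReal_two_rpow, Real.rpow_neg two_pos.le, one_div]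
            exact ENNReal.ofReal_le_ofReal (inv_anti₀ (by positivity) ht.1.le)
        _ = (2 ^ (θ * δ) * e (s + 1)) ^ q.toReal * 2 ^ (-(δ * s)) * volume (dyadicIoc δ s) := by
            rw [setLIntegral_const]
        _ ≤ (2 ^ (θ * δ) * e (s + 1)) ^ q.toReal * 2 ^ (-(δ * s)) * 2 ^ (δ * (s + 1)) := by
            gcongr
            rw [volume_dyadicIoc]
            refine mul_le_of_le_one_right zero_le ?_
            rw [ENNReal.ofReal_le_one]
            have : (0 : ℝ) < 2 ^ (-δ) := by positivity
            linarith
        _ = _ := by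
            rw [hD, ENNReal.mul_rpow_of_nonneg _ _ hp.le, mul_assoc _ (2 ^ (-(δ * (s : ℝ)))),
              ← two_rpow_add, show -(δ * (s : ℝ)) + δ * (s + 1) = δ by ring]
            ring
    calc ∫⁻ t in Set.Ioi (0 : ℝ), F t
        ≤ ∫⁻ t in Set.Ioc 0 1 ∪ ⋃ s, dyadicIoc δ s, F t :=
          lintegral_mono_set (Ioi_subset_dyadicIoc hδ)
      _ ≤ (∫⁻ t in Set.Ioc 0 1, F t) + ∫⁻ t in ⋃ s, dyadicIoc δ s, F t := lintegral_union_le _ _ _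
      _ ≤ I₀ * e 0 ^ q.toReal + ∑' s, ∫⁻ t in dyadicIoc δ s, F t :=
          add_le_add h0 (lintegral_iUnion_le _ _)
      _ ≤ I₀ * ∑' s, e s ^ q.toReal + ∑' s, D * e (s + 1) ^ q.toReal :=
          add_le_add (by gcongr; exact ENNReal.le_tsum (f := fun s => e s ^ q.toReal) 0)
            (ENNReal.tsum_le_tsum hs)
      _ ≤ I₀ * ∑' s, e s ^ q.toReal + D * ∑' s, e s ^ q.toReal := by
          rw [ENNReal.tsum_mul_left]
          refine add_le_add le_rfl (mul_le_mul' le_rfl ?_)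
          exact ENNReal.tsum_comp_le_tsum_of_injective (add_left_injective 1)
            (fun s => e s ^ q.toReal)
      _ = _ := by rw [add_mul]

end Discretization

/-! ### Abstract interpolation for tail functionals -/

section TailInterpolation

variable {V : Type*} [AddCommGroup V]

/-- A subadditive sequence-valued functional for which every vector splits at every level
into a low-frequency part and a high-frequency part. -/
structure IsTailFunctional (τ : V → ℕ → ℝ≥0∞) : Prop where
  add_le : ∀ f g s, τ (f + g) s ≤ τ f s + τ g s
  split : ∀ f m, ∃ f₀ f₁, f₀ + f₁ = f ∧ (∀ j < m, τ f₀ j ≤ τ f j) ∧ (∀ j, m ≤ j → τ f₀ j = 0) ∧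
    ∀ j, τ f₁ j ≤ τ f (max j m)

/-- The weighted `ℓ^q` quasi-norm `‖2^{ρ s} τ f s‖_{ℓ^q}`. -/
def tailNorm (τ : V → ℕ → ℝ≥0∞) (ρ : ℝ) (q : ℝ≥0∞) (f : V) : ℝ≥0∞ :=
  lqNorm q fun s => 2 ^ (ρ * s) * τ f s

lemma kFunctional_le (N₀ N₁ : V → ℝ≥0∞) (t : ℝ) {f f₀ f₁ : V} (h : f₀ + f₁ = f) :
    kFunctional N₀ N₁ t f ≤ N₀ f₀ + ENNReal.ofReal t * N₁ f₁ :=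
  (iInf₂_le f₀ f₁).trans (iInf_le _ h)

lemma interpNorm_eq_weightedLqNorm (N₀ N₁ : V → ℝ≥0∞) (θ : ℝ) (q : ℝ≥0∞) (f : V) :
    interpNorm N₀ N₁ θ q f = weightedLqNorm θ q fun t => kFunctional N₀ N₁ t f := rfl

lemma exists_add_eq_of_kFunctional_lt_top {N₀ N₁ : V → ℝ≥0∞} {t : ℝ} (ht : 0 < t) {f : V}
    (h : kFunctional N₀ N₁ t f < ⊤) :
    ∃ f₀ ∈ finiteSet N₀, ∃ f₁ ∈ finiteSet N₁, f₀ + f₁ = f := by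
  simp only [kFunctional, iInf_lt_iff] at h
  obtain ⟨f₀, f₁, hf, hlt⟩ := h
  rw [ENNReal.add_lt_top] at hlt
  refine ⟨f₀, hlt.1, f₁, ?_, hf⟩
  refine (lt_top_iff_ne_top.2 fun h1 => hlt.2.ne ?_ : N₁ f₁ < ⊤)
  rw [h1, ENNReal.mul_top]
  simpa using ht

variable {τ : V → ℕ → ℝ≥0∞}

lemma IsTailFunctional.le_kFunctional (hτ : IsTailFunctional τ) {ρ₀ ρ₁ : ℝ} {β₀ β₁ : ℝ≥0∞}
    (hβ₀ : 0 < β₀) (hβ₁ : 0 < β₁) (f : V) (s : ℕ) {t : ℝ} (ht : 2 ^ ((ρ₀ - ρ₁) * s) ≤ t) :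
    2 ^ (ρ₀ * s) * τ f s ≤ kFunctional (tailNorm τ ρ₀ β₀) (tailNorm τ ρ₁ β₁) t f := by
  refine le_iInf fun f₀ => le_iInf fun f₁ => le_iInf fun h => ?_
  calc 2 ^ (ρ₀ * s) * τ f s ≤ 2 ^ (ρ₀ * s) * (τ f₀ s + τ f₁ s) := by
        gcongr; rw [← h]; exact hτ.add_le _ _ _
    _ = 2 ^ (ρ₀ * s) * τ f₀ s + 2 ^ ((ρ₀ - ρ₁) * s) * (2 ^ (ρ₁ * s) * τ f₁ s) := by
        rw [mul_add, ← mul_assoc (2 ^ ((ρ₀ - ρ₁) * (s : ℝ))), ← two_rpow_add]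
        ring_nf
    _ ≤ _ := by
        refine add_le_add (le_lqNorm hβ₀ _ s) (mul_le_mul' ?_ (le_lqNorm hβ₁ _ s))
        rw [← ofReal_two_rpow]
        exact ENNReal.ofReal_le_ofReal ht

/-- With `b j = 2^(ρ j) τ f j`, the relation `ρ = ρ₀ - θδ = ρ₁ + (1-θ)δ` turns the weights `ρ₀`
below `m` and `ρ₁` above `m` into powers of `2^m` times `b j` with a factor decaying in `|m - j|`.
-/
lemma IsTailFunctional.kFunctional_le_geomMax (hτ : IsTailFunctional τ) {ρ₀ ρ₁ ρ θ ε : ℝ}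
    (hε : 0 < ε) (hρ₁ : 2 * ε ≤ ρ₁) (hε₀ : 2 * ε ≤ θ * (ρ₀ - ρ₁)) (hε₁ : 2 * ε ≤ (1 - θ) * (ρ₀ - ρ₁))
    (hρ : ρ = (1 - θ) * ρ₀ + θ * ρ₁) {β₀ β₁ : ℝ≥0∞}
    (hβ₀ : 0 < β₀) (hβ₁ : 0 < β₁) {C₀ C₁ : ℝ≥0}
    (hC₀ : ∀ m : ℕ, lqNorm β₀ (fun j : ℕ => 2 ^ (-ε * |(m : ℝ) - j|)) ≤ C₀)
    (hC₁ : ∀ m : ℕ, lqNorm β₁ (fun j : ℕ => 2 ^ (-ε * |(m : ℝ) - j|)) ≤ C₁)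
    (f : V) (m : ℕ) {t : ℝ} (ht : t ≤ 2 ^ ((ρ₀ - ρ₁) * m)) :
    kFunctional (tailNorm τ ρ₀ β₀) (tailNorm τ ρ₁ β₁) t f ≤
      2 ^ (θ * ((ρ₀ - ρ₁) * m)) *
        (((C₀ + C₁ : ℝ≥0) : ℝ≥0∞) * geomMax ε (fun s => 2 ^ (ρ * s) * τ f s) m) := by
  set δ := ρ₀ - ρ₁ with hδ
  set E := geomMax ε (fun s => 2 ^ (ρ * s) * τ f s) m with hE
  have hEle : ∀ j : ℕ, 2 ^ (-ε * |(m : ℝ) - j|) * (2 ^ (ρ * j) * τ f j) ≤ E := fun j =>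
    le_iSup (fun j : ℕ => 2 ^ (-ε * |(m : ℝ) - j|) * (2 ^ (ρ * j) * τ f j)) j
  obtain ⟨f₀, f₁, hf, h0, h0', h1⟩ := hτ.split f m
  -- The decay rate `2ε` is shared: one half is absorbed in `geomMax`, the other is left over to be
  -- summed in `ℓ^β`.
  have key : ∀ (x : ℝ) (j : ℕ), x ≤ -(2 * ε) * |(m : ℝ) - j| →
      2 ^ x * (2 ^ (ρ * j) * τ f j) ≤ 2 ^ (-ε * |(m : ℝ) - j|) * E := by
    intro x j hx
    calc _ ≤ 2 ^ (-ε * |(m : ℝ) - j|) *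
          (2 ^ (-ε * |(m : ℝ) - j|) * (2 ^ (ρ * j) * τ f j)) := by
          rw [← mul_assoc _ _ (2 ^ (ρ * (j : ℝ)) * τ f j), ← two_rpow_add]
          exact mul_le_mul' (two_rpow_le (by linarith)) le_rfl
      _ ≤ _ := by gcongr; exact hEle j
  have hN : ∀ (β : ℝ≥0∞) (C : ℝ≥0), 0 < β →
      lqNorm β (fun j : ℕ => 2 ^ (-ε * |(m : ℝ) - j|)) ≤ C → ∀ (y : ℝ) (u : ℕ → ℝ≥0∞),
      (∀ j : ℕ, u j ≤ 2 ^ y * (2 ^ (-ε * |(m : ℝ) - j|) * E)) →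
      lqNorm β u ≤ 2 ^ y * (C * E) := by
    intro β C hβ hC y u hu
    calc lqNorm β u ≤ lqNorm β fun j : ℕ => (2 ^ y * E) * 2 ^ (-ε * |(m : ℝ) - j|) :=
          lqNorm_mono β fun j => (hu j).trans (le_of_eq (by ring))
      _ = (2 ^ y * E) * lqNorm β fun j : ℕ => 2 ^ (-ε * |(m : ℝ) - j|) := lqNorm_const_mul hβ _ _
      _ ≤ (2 ^ y * E) * C := by gcongr
      _ = _ := by ring
  have hN0 : tailNorm τ ρ₀ β₀ f₀ ≤ 2 ^ (θ * (δ * m)) * (C₀ * E) := by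
    refine hN β₀ C₀ hβ₀ (hC₀ m) _ _ fun j => ?_
    by_cases hj : j < m
    · have hj' : (j : ℝ) ≤ m := by exact_mod_cast hj.le
      calc 2 ^ (ρ₀ * j) * τ f₀ j ≤ 2 ^ (ρ₀ * j) * τ f j := by gcongr; exact h0 j hj
        _ = 2 ^ (θ * (δ * m)) * (2 ^ (-(θ * δ) * (m - j)) * (2 ^ (ρ * j) * τ f j)) := by
            rw [← mul_assoc, ← mul_assoc, ← two_rpow_add, ← two_rpow_add]
            congr 2
            rw [hρ, hδ]; ring
        _ ≤ _ := by
            refine mul_le_mul' le_rfl (key _ j ?_)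
            rw [abs_of_nonneg (by linarith)]
            exact mul_le_mul_of_nonneg_right (by linarith) (by linarith)
    · rw [h0' j (not_lt.1 hj)]; simp
  have hN1 : tailNorm τ ρ₁ β₁ f₁ ≤ 2 ^ (-((1 - θ) * (δ * m))) * (C₁ * E) := by
    refine hN β₁ C₁ hβ₁ (hC₁ m) _ _ fun j => ?_
    rcases le_total m j with hj | hj
    · have hj' : (m : ℝ) ≤ j := by exact_mod_cast hj
      calc 2 ^ (ρ₁ * j) * τ f₁ j ≤ 2 ^ (ρ₁ * j) * τ f j := by
            gcongr; simpa [max_eq_left hj] using h1 j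
        _ = 2 ^ (-((1 - θ) * (δ * m))) *
              (2 ^ (-((1 - θ) * δ) * (j - m)) * (2 ^ (ρ * j) * τ f j)) := by
            rw [← mul_assoc, ← mul_assoc, ← two_rpow_add, ← two_rpow_add]
            congr 2
            rw [hρ, hδ]; ring
        _ ≤ _ := by
            refine mul_le_mul' le_rfl (key _ j ?_)
            rw [abs_sub_comm, abs_of_nonneg (by linarith)]
            exact mul_le_mul_of_nonneg_right (by linarith) (by linarith)
    -- Below level `m` the tails of `f₁` are only bounded by the constant `τ f m`; the decay comes
    -- from the weight `2^(ρ₁ j)`, which is why `ρ₁` must be positive.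
    · have hj' : (j : ℝ) ≤ m := by exact_mod_cast hj
      have hEm : 2 ^ (ρ * m) * τ f m ≤ E := by simpa using hEle m
      calc 2 ^ (ρ₁ * j) * τ f₁ j ≤ 2 ^ (ρ₁ * j) * τ f m := by
            gcongr; simpa [max_eq_right hj] using h1 j
        _ = 2 ^ (-((1 - θ) * (δ * m))) *
              (2 ^ (-ρ₁ * (m - j)) * (2 ^ (ρ * m) * τ f m)) := by
            rw [← mul_assoc, ← mul_assoc, ← two_rpow_add, ← two_rpow_add]
            congr 2
            rw [hρ, hδ]; ring
        _ ≤ _ := by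
            refine mul_le_mul' le_rfl (mul_le_mul' (two_rpow_le ?_) hEm)
            rw [abs_of_nonneg (by linarith)]
            exact mul_le_mul_of_nonneg_right (by linarith) (by linarith)
  calc _ ≤ tailNorm τ ρ₀ β₀ f₀ + ENNReal.ofReal t * tailNorm τ ρ₁ β₁ f₁ := kFunctional_le _ _ _ hf
    _ ≤ 2 ^ (θ * (δ * m)) * (C₀ * E) +
          2 ^ (δ * m) * (2 ^ (-((1 - θ) * (δ * m))) * (C₁ * E)) := by
        refine add_le_add hN0 (mul_le_mul' ?_ hN1)
        rw [← ofReal_two_rpow]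
        exact ENNReal.ofReal_le_ofReal ht
    _ = _ := by
        rw [← mul_assoc (2 ^ (δ * (m : ℝ))), ← two_rpow_add,
          show δ * (m : ℝ) + -((1 - θ) * (δ * m)) = θ * (δ * m) by ring]
        push_cast
        ring

/-- Splitting at level `0` leaves no tail in the first piece, so only the term carrying the factor
`t` survives. -/
lemma IsTailFunctional.kFunctional_le_ofReal_mul (hτ : IsTailFunctional τ) {ρ₀ ρ₁ ρ ε : ℝ}
    (hε : 2 * ε ≤ ρ - ρ₁) {β₀ β₁ : ℝ≥0∞} (hβ₀ : 0 < β₀) (hβ₁ : 0 < β₁) {C₁ : ℝ≥0}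
    (hC₁ : ∀ m : ℕ, lqNorm β₁ (fun j : ℕ => 2 ^ (-ε * |(m : ℝ) - j|)) ≤ C₁)
    (f : V) (t : ℝ) :
    kFunctional (tailNorm τ ρ₀ β₀) (tailNorm τ ρ₁ β₁) t f ≤
      ENNReal.ofReal t * (C₁ * geomMax ε (fun s => 2 ^ (ρ * s) * τ f s) 0) := by
  set E := geomMax ε (fun s => 2 ^ (ρ * s) * τ f s) 0 with hE
  have hEle : ∀ j : ℕ, 2 ^ (-ε * (j : ℝ)) * (2 ^ (ρ * j) * τ f j) ≤ E := fun j => by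
    rw [hE, geomMax]
    simpa using le_iSup (fun j : ℕ => 2 ^ (-ε * |((0 : ℕ) : ℝ) - j|) * (2 ^ (ρ * j) * τ f j)) j
  obtain ⟨f₀, f₁, hf, -, h0, h1⟩ := hτ.split f 0
  have hN0 : tailNorm τ ρ₀ β₀ f₀ = 0 := by
    have : (fun s : ℕ => 2 ^ (ρ₀ * s) * τ f₀ s) = fun s : ℕ => (0 : ℝ≥0∞) * 0 := by
      ext s; rw [h0 s (Nat.zero_le s)]; simp
    rw [tailNorm, this, lqNorm_const_mul hβ₀, zero_mul]
  have hN1 : tailNorm τ ρ₁ β₁ f₁ ≤ C₁ * E := by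
    calc tailNorm τ ρ₁ β₁ f₁
        ≤ lqNorm β₁ fun j : ℕ => E * 2 ^ (-ε * |((0 : ℕ) : ℝ) - j|) := by
          refine lqNorm_mono β₁ fun j => ?_
          calc 2 ^ (ρ₁ * j) * τ f₁ j ≤ 2 ^ (ρ₁ * j) * τ f j := by
                gcongr; simpa using h1 j
            _ = 2 ^ (-(ρ - ρ₁) * j) * (2 ^ (ρ * j) * τ f j) := by
                rw [← mul_assoc, ← two_rpow_add]; ring_nf
            _ ≤ 2 ^ (-ε * (j : ℝ)) * (2 ^ (-ε * (j : ℝ)) * (2 ^ (ρ * j) * τ f j)) := by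
                rw [← mul_assoc _ _ (2 ^ (ρ * (j : ℝ)) * τ f j), ← two_rpow_add]
                refine mul_le_mul' (two_rpow_le ?_) le_rfl
                have := mul_le_mul_of_nonneg_right hε (Nat.cast_nonneg (α := ℝ) j)
                linarith
            _ ≤ 2 ^ (-ε * (j : ℝ)) * E := by gcongr; exact hEle j
            _ = _ := by simp [mul_comm]
      _ = E * lqNorm β₁ fun j : ℕ => 2 ^ (-ε * |((0 : ℕ) : ℝ) - j|) := lqNorm_const_mul hβ₁ _ _
      _ ≤ E * C₁ := by gcongr; exact hC₁ 0
      _ = _ := mul_comm _ _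
  refine (kFunctional_le _ _ t hf).trans ?_
  rw [hN0, zero_add]
  gcongr

/-- Real interpolation of the spaces defined by the quasi-norms `‖2^{ρ s} τ f s‖_{ℓ^β}`. -/
theorem IsTailFunctional.interpolation (hτ : IsTailFunctional τ) {ρ₀ ρ₁ ρ θ : ℝ}
    (hρ₁ : 0 < ρ₁) (hρ₀ : ρ₁ < ρ₀) (hθ : 0 < θ) (hθ1 : θ < 1)
    (hρ : ρ = (1 - θ) * ρ₀ + θ * ρ₁) {β₀ β₁ q : ℝ≥0∞}
    (hβ₀ : 0 < β₀) (hβ₁ : 0 < β₁) (hq : 0 < q) :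
    interpSpace (tailNorm τ ρ₀ β₀) (tailNorm τ ρ₁ β₁) θ q = finiteSet (tailNorm τ ρ q) ∧
    EquivalentNorms (interpNorm (tailNorm τ ρ₀ β₀) (tailNorm τ ρ₁ β₁) θ q)
      (tailNorm τ ρ q) := by
  have hδ : 0 < ρ₀ - ρ₁ := sub_pos.2 hρ₀
  obtain ⟨ε, hε, e1, e2, e3⟩ : ∃ ε : ℝ, 0 < ε ∧ 2 * ε ≤ ρ₁ ∧ 2 * ε ≤ θ * (ρ₀ - ρ₁) ∧
      2 * ε ≤ (1 - θ) * (ρ₀ - ρ₁) := by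
    have h1 := mul_pos hθ hδ
    have h2 := mul_pos (sub_pos.2 hθ1) hδ
    refine ⟨min ρ₁ (min (θ * (ρ₀ - ρ₁)) ((1 - θ) * (ρ₀ - ρ₁))) / 2, by positivity, ?_, ?_, ?_⟩
    · rw [mul_div_cancel₀ _ two_ne_zero]; exact min_le_left _ _
    · rw [mul_div_cancel₀ _ two_ne_zero]; exact (min_le_right _ _).trans (min_le_left _ _)
    · rw [mul_div_cancel₀ _ two_ne_zero]; exact (min_le_right _ _).trans (min_le_right _ _)
  -- Here `ρ - ρ₁ = (1 - θ)(ρ₀ - ρ₁)`.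
  have e4 : 2 * ε ≤ ρ - ρ₁ := by rw [hρ]; linarith
  obtain ⟨C₀, hC₀⟩ := lqNorm_two_rpow_dist_le hε hβ₀
  obtain ⟨C₁, hC₁⟩ := lqNorm_two_rpow_dist_le hε hβ₁
  obtain ⟨C₂, hC₂⟩ := lqNorm_geomMax_le hε hq
  obtain ⟨C₃, hC₃⟩ := lqNorm_le_weightedLqNorm hθ hδ hq
  obtain ⟨C₄, hC₄⟩ := weightedLqNorm_le_lqNorm hθ hθ1 hδ hq
  have hup : ∀ f, kFunctional (tailNorm τ ρ₀ β₀) (tailNorm τ ρ₁ β₁) 1 f ≤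
      ((C₀ + C₁ : ℝ≥0) : ℝ≥0∞) * (C₂ * tailNorm τ ρ q f) := by
    intro f
    have := hτ.kFunctional_le_geomMax hε e1 e2 e3 hρ hβ₀ hβ₁ hC₀ hC₁ f 0 (t := 1) (by simp)
    refine this.trans ?_
    simp only [CharP.cast_eq_zero, mul_zero, ENNReal.rpow_zero, one_mul]
    gcongr
    exact (le_lqNorm hq _ 0).trans (hC₂ _)
  have A : ∀ f, interpNorm (tailNorm τ ρ₀ β₀) (tailNorm τ ρ₁ β₁) θ q f ≤
      ((C₄ * ((C₀ + C₁) * C₂) : ℝ≥0) : ℝ≥0∞) * tailNorm τ ρ q f := by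
    intro f
    rw [interpNorm_eq_weightedLqNorm]
    refine (hC₄ (fun m => ((C₀ + C₁ : ℝ≥0) : ℝ≥0∞) *
      geomMax ε (fun s => 2 ^ (ρ * s) * τ f s) m) _ (fun s t _ ht => ?_)
      (fun t _ _ => ?_)).trans ?_
    · exact hτ.kFunctional_le_geomMax hε e1 e2 e3 hρ hβ₀ hβ₁ hC₀ hC₁ f s ht
    · refine (hτ.kFunctional_le_ofReal_mul e4 hβ₀ hβ₁ hC₁ f t).trans ?_
      gcongr
      exact le_add_self
    · rw [lqNorm_const_mul hq, ENNReal.coe_mul, ENNReal.coe_mul, mul_assoc, mul_assoc]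
      gcongr
      exact hC₂ _
  have B : ∀ f, tailNorm τ ρ q f ≤
      C₃ * interpNorm (tailNorm τ ρ₀ β₀) (tailNorm τ ρ₁ β₁) θ q f := by
    intro f
    rw [interpNorm_eq_weightedLqNorm]
    refine hC₃ _ _ fun s t ht => ?_
    refine le_trans (le_of_eq ?_) (hτ.le_kFunctional hβ₀ hβ₁ f s ht)
    rw [← mul_assoc, ← two_rpow_add]
    congr 2
    rw [hρ]; ring
  constructor
  · ext f
    constructor
    · rintro ⟨-, h⟩
      exact (B f).trans_lt (ENNReal.mul_lt_top ENNReal.coe_lt_top h)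
    -- Finiteness of `K(1, f)` alone places `f` in the sum of the two spaces.
    · intro h
      refine ⟨exists_add_eq_of_kFunctional_lt_top one_pos ((hup f).trans_lt ?_),
        (A f).trans_lt (ENNReal.mul_lt_top ENNReal.coe_lt_top h)⟩
      exact ENNReal.mul_lt_top ENNReal.coe_lt_top (ENNReal.mul_lt_top ENNReal.coe_lt_top h)
  · refine ⟨C₄ * ((C₀ + C₁) * C₂) + C₃ + 1, by positivity, fun f => ⟨(A f).trans ?_, (B f).trans ?_⟩⟩
    · gcongr
      rw [add_assoc]
      exact le_self_add
    · gcongr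
      exact le_add_self.trans le_self_add

end TailInterpolation

/-! ### Schur orthogonality and distributions with prescribed Fourier coefficients -/

lemma integrable_of_continuous {G : Type*} [TopologicalSpace G] [CompactSpace G]
    [MeasurableSpace G] [BorelSpace G] (μ : Measure G) [IsFiniteMeasure μ] {h : G → ℂ}
    (hh : Continuous h) : Integrable h μ :=
  hh.integrable_of_hasCompactSupport (HasCompactSupport.of_compactSpace h)

section Schur

variable {n : ℕ} {G : Type*} [Group G] [TopologicalSpace G]
  [ChartedSpace (EuclideanSpace ℝ (Fin n)) G]

namespace UnitaryIrrep

lemma dim_pos (ξ : UnitaryIrrep n G) : 0 < ξ.dim := by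
  by_contra h
  have h0 : ξ.dim = 0 := by omega
  have : IsEmpty (Fin ξ.dim) := by rw [h0]; infer_instance
  have hn := ξ.irreducible.toNontrivial
  obtain ⟨p, q, hpq⟩ := hn
  exact hpq (Subrepresentation.toSubmodule_injective (Subsingleton.elim _ _))

lemma conjTranspose_mul_self (ξ : UnitaryIrrep n G) (x : G) :
    (ξ.toHom x).conjTranspose * ξ.toHom x = 1 :=
  Matrix.mem_unitaryGroup_iff'.1 (ξ.unitary x)

lemma self_mul_conjTranspose (ξ : UnitaryIrrep n G) (x : G) :
    ξ.toHom x * (ξ.toHom x).conjTranspose = 1 :=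
  Matrix.mem_unitaryGroup_iff.1 (ξ.unitary x)

lemma toHom_inv (ξ : UnitaryIrrep n G) (x : G) :
    ξ.toHom x⁻¹ = (ξ.toHom x).conjTranspose := by
  calc ξ.toHom x⁻¹ = ξ.toHom x⁻¹ * (ξ.toHom x * (ξ.toHom x).conjTranspose) := by
        rw [self_mul_conjTranspose, mul_one]
    _ = _ := by rw [← mul_assoc, ← map_mul]; simp

/-- Schur's lemma: a matrix in the commutant of an irreducible representation is scalar. -/
lemma eq_smul_one_of_commute (ξ : UnitaryIrrep n G) (T : Matrix (Fin ξ.dim) (Fin ξ.dim) ℂ)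
    (h : ∀ x, T * ξ.toHom x = ξ.toHom x * T) : ∃ c : ℂ, T = c • 1 := by
  set ρ : Representation ℂ G (Fin ξ.dim → ℂ) :=
    (((Matrix.toLinAlgEquiv' : Matrix (Fin ξ.dim) (Fin ξ.dim) ℂ ≃ₐ[ℂ] _) :
      Matrix (Fin ξ.dim) (Fin ξ.dim) ℂ →* Module.End ℂ (Fin ξ.dim → ℂ)).comp ξ.toHom) with hρ
  have : Representation.IsIrreducible ρ := ξ.irreducible
  have hρa : ∀ g, ρ g = Matrix.toLinAlgEquiv' (ξ.toHom g) := fun g => rfl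
  let f : Representation.IntertwiningMap ρ ρ :=
    ⟨Matrix.toLinAlgEquiv' T, fun g => by
      rw [hρa]
      change Matrix.toLinAlgEquiv' T * Matrix.toLinAlgEquiv' (ξ.toHom g) =
        Matrix.toLinAlgEquiv' (ξ.toHom g) * Matrix.toLinAlgEquiv' T
      rw [← map_mul, ← map_mul, h]⟩
  obtain ⟨c, hc⟩ :=
    (Representation.IsIrreducible.algebraMap_intertwiningMap_bijective_of_isAlgClosed
      (ρ := ρ)).2 f
  refine ⟨c, (Matrix.toLinAlgEquiv' (R := ℂ) (n := Fin ξ.dim)).injective ?_⟩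
  have h2 := congrArg Representation.IntertwiningMap.toLinearMap hc
  rw [Representation.IntertwiningMap.algebraMap_apply] at h2
  rw [map_smul, map_one]
  exact h2.symm

open scoped ComplexOrder in
/-- Schur's lemma: a nonzero intertwiner of irreducible unitary representations is a multiple of a
unitary one. -/
lemma equivalent_of_intertwiner (ξ η : UnitaryIrrep n G) (T : Matrix (Fin η.dim) (Fin ξ.dim) ℂ)
    (h : ∀ x, T * ξ.toHom x = η.toHom x * T) (hT : T ≠ 0) : ξ.Equivalent η := by
  have h' : ∀ x, T.conjTranspose * η.toHom x = ξ.toHom x * T.conjTranspose := by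
    intro x
    have := congrArg Matrix.conjTranspose (h x⁻¹)
    simpa [Matrix.conjTranspose_mul, toHom_inv] using this.symm
  obtain ⟨c, hc⟩ := ξ.eq_smul_one_of_commute (T.conjTranspose * T) fun x => by
    rw [Matrix.mul_assoc, h, ← Matrix.mul_assoc, h', Matrix.mul_assoc]
  obtain ⟨c', hc'⟩ := η.eq_smul_one_of_commute (T * T.conjTranspose) fun x => by
    rw [Matrix.mul_assoc, h', ← Matrix.mul_assoc, h, Matrix.mul_assoc]
  -- Both scalars come out of the triple product `T T* T`.
  have hcc : c = c' := by
    have h1 : c • T = c' • T := by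
      calc c • T = T * (T.conjTranspose * T) := by rw [hc]; simp
        _ = c' • T := by rw [← Matrix.mul_assoc, hc']; simp
    rw [← sub_eq_zero, ← sub_smul, smul_eq_zero] at h1
    exact sub_eq_zero.1 (h1.resolve_right hT)
  have hc0 : c ≠ 0 := by
    rintro rfl
    rw [zero_smul] at hc
    exact hT (Matrix.conjTranspose_mul_self_eq_zero.1 hc)
  let i : Fin ξ.dim := ⟨0, ξ.dim_pos⟩
  -- A diagonal entry of `T* T` is the squared norm of a column of `T`, so `c` is a nonnegative real
  -- and `T / √c` is unitary.
  obtain ⟨a, ha0, hac⟩ : ∃ a : ℝ, 0 ≤ a ∧ (a : ℂ) = c := by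
    refine ⟨∑ k, ‖T k i‖ ^ 2, by positivity, ?_⟩
    have := congrFun (congrFun hc i) i
    simp only [Matrix.mul_apply, Matrix.conjTranspose_apply, Matrix.smul_apply, Matrix.one_apply_eq,
      smul_eq_mul, mul_one] at this
    rw [← this]
    push_cast
    refine Finset.sum_congr rfl fun k _ => ?_
    rw [RCLike.star_def, Complex.conj_mul']
  have ha : 0 < a := lt_of_le_of_ne ha0 (by rintro rfl; exact hc0 (by simpa using hac.symm))
  set b : ℂ := (((√a)⁻¹ : ℝ) : ℂ) with hb
  have hbb : star b * b * c = 1 := by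
    rw [hb, ← hac, RCLike.star_def, Complex.conj_ofReal, ← Complex.ofReal_mul,
      ← Complex.ofReal_mul, ← mul_inv, Real.mul_self_sqrt ha.le, inv_mul_cancel₀ ha.ne']
    simp
  refine ⟨b • T, ?_, ?_, fun x => ?_⟩
  · rw [Matrix.conjTranspose_smul, Matrix.smul_mul, Matrix.mul_smul, hc, smul_smul, smul_smul,
      hbb, one_smul]
  · rw [Matrix.conjTranspose_smul, Matrix.smul_mul, Matrix.mul_smul, hc', ← hcc, smul_smul,
      smul_smul, mul_comm b, hbb, one_smul]
  · rw [Matrix.smul_mul, h, Matrix.mul_smul]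

lemma continuous_toHom_apply (ξ : UnitaryIrrep n G) (i j : Fin ξ.dim) :
    Continuous fun x => ξ.toHom x i j := (ξ.smooth i j).continuous

lemma continuous_trace (ξ : UnitaryIrrep n G) :
    Continuous fun x => (ξ.toHom x).trace :=
  continuous_finsetSum _ fun i _ => ξ.continuous_toHom_apply i i

variable [CompactSpace G] [MeasurableSpace G] [BorelSpace G] (μ : Measure G)
  [IsProbabilityMeasure μ]

/-- The matrix `(∫ η_{ik} \overline{ξ_{jl}})_{ij}`. -/
def coeffInner (η ξ : UnitaryIrrep n G) (k : Fin η.dim) (l : Fin ξ.dim) :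
    Matrix (Fin η.dim) (Fin ξ.dim) ℂ :=
  Matrix.of fun i j => ∫ x, η.toHom x i k * star (ξ.toHom x j l) ∂μ

lemma integrable_coeff_mul (η ξ : UnitaryIrrep n G) (i k : Fin η.dim) (j l : Fin ξ.dim) :
    Integrable (fun x => η.toHom x i k * star (ξ.toHom x j l)) μ :=
  integrable_of_continuous μ
    ((η.continuous_toHom_apply i k).mul (ξ.continuous_toHom_apply j l).star)

variable [μ.IsMulLeftInvariant] [IsTopologicalGroup G]

/-- `coeffInner` averages rank-one matrices built from columns of `η(x)` and `ξ(x)`; moving `g`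
across it is the substitution `x ↦ g x`, under which `μ` is invariant. -/
lemma coeffInner_mul (η ξ : UnitaryIrrep n G) (k : Fin η.dim) (l : Fin ξ.dim) (g : G) :
    coeffInner μ η ξ k l * ξ.toHom g = η.toHom g * coeffInner μ η ξ k l := by
  ext i j
  have hL : (η.toHom g * coeffInner μ η ξ k l) i j =
      ∫ x, η.toHom (g * x) i k * star (ξ.toHom x j l) ∂μ := by
    simp only [Matrix.mul_apply, coeffInner, Matrix.of_apply, map_mul, Finset.sum_mul,
      ← integral_const_mul]
    rw [integral_finsetSum]
    · simp only [mul_assoc]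
    · intro a _
      simp only [mul_assoc]
      exact (integrable_coeff_mul μ η ξ a k j l).const_mul _
  have hR : (coeffInner μ η ξ k l * ξ.toHom g) i j =
      ∫ x, η.toHom x i k * star (ξ.toHom (g⁻¹ * x) j l) ∂μ := by
    simp only [Matrix.mul_apply, coeffInner, Matrix.of_apply, map_mul, star_sum, star_mul',
      Finset.mul_sum, ← integral_mul_const]
    rw [integral_finsetSum]
    · refine Finset.sum_congr rfl fun a _ => integral_congr_ae (Filter.Eventually.of_forall
        fun x => ?_)
      simp only [toHom_inv, Matrix.conjTranspose_apply, star_star]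
      ring
    · intro a _
      have h := (integrable_coeff_mul μ η ξ i k a l).const_mul (star (ξ.toHom g⁻¹ j a))
      refine h.congr (Filter.Eventually.of_forall fun x => ?_)
      simp only
      ring
  rw [hL, hR, ← integral_mul_left_eq_self (μ := μ)
    (fun x => η.toHom x i k * star (ξ.toHom (g⁻¹ * x) j l)) g]
  simp

/-- Schur orthogonality for inequivalent representations. -/
lemma integral_coeff_of_not_equivalent {η ξ : UnitaryIrrep n G} (h : ¬ ξ.Equivalent η)
    (i k : Fin η.dim) (j l : Fin ξ.dim) :
    ∫ x, η.toHom x i k * star (ξ.toHom x j l) ∂μ = 0 := by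
  by_contra h0
  refine h (equivalent_of_intertwiner ξ η (coeffInner μ η ξ k l)
    (coeffInner_mul μ η ξ k l) fun hT => h0 ?_)
  exact congrFun (congrFun hT i) j

/-- Schur orthogonality for the matrix coefficients of one representation. -/
lemma integral_coeff_self (ξ : UnitaryIrrep n G) (i k j l : Fin ξ.dim) :
    ∫ x, ξ.toHom x i k * star (ξ.toHom x j l) ∂μ =
      if i = j ∧ k = l then (ξ.dim : ℂ)⁻¹ else 0 := by
  obtain ⟨c, hc⟩ := ξ.eq_smul_one_of_commute (coeffInner μ ξ ξ k l)
    (coeffInner_mul μ ξ ξ k l)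
  have hij : ∫ x, ξ.toHom x i k * star (ξ.toHom x j l) ∂μ = c * (1 : Matrix _ _ ℂ) i j :=
    congrFun (congrFun hc i) j
  -- The scalar is determined by the trace, where the columns of a unitary matrix make the integrand
  -- constant.
  have htr : ∑ i, coeffInner μ ξ ξ k l i i = (1 : Matrix (Fin ξ.dim) (Fin ξ.dim) ℂ) l k := by
    simp only [coeffInner, Matrix.of_apply]
    rw [← integral_finsetSum _ fun a _ => integrable_coeff_mul μ ξ ξ a k a l]
    have : ∀ x, ∑ a, ξ.toHom x a k * star (ξ.toHom x a l) =
        (1 : Matrix (Fin ξ.dim) (Fin ξ.dim) ℂ) l k := by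
      intro x
      rw [← ξ.conjTranspose_mul_self x, Matrix.mul_apply]
      simp [mul_comm]
    simp_rw [this]
    simp
  have hd : (ξ.dim : ℂ) ≠ 0 := by exact_mod_cast ξ.dim_pos.ne'
  have hcd : c * ξ.dim = (1 : Matrix (Fin ξ.dim) (Fin ξ.dim) ℂ) l k := by
    rw [← htr, hc]; simp [mul_comm]
  rw [hij, eq_div_of_mul_eq hd hcd, Matrix.one_apply, Matrix.one_apply]
  by_cases h1 : i = j <;> by_cases h2 : k = l <;> simp [h1, h2, eq_comm]

end UnitaryIrrep

section Density

variable [CompactSpace G] [MeasurableSpace G] [BorelSpace G] (μ : Measure G)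
  [IsProbabilityMeasure μ]

/-- The distribution with continuous density `h`. -/
def densityDistribution (h : G → ℂ) (hh : Continuous h) : distributions n G :=
  ⟨{ toFun := fun φ => ∫ x, h x * φ.1 x ∂μ
     map_add' := fun φ ψ => by
        rw [← integral_add]
        · simp [mul_add]
        · exact integrable_of_continuous μ (hh.mul φ.2.continuous)
        · exact integrable_of_continuous μ (hh.mul ψ.2.continuous)
     map_smul' := fun c φ => by
        simp [← integral_const_mul, mul_left_comm] },
    by
      -- The empty word gives the sup norm, which suffices for a continuous density; the constant is
      -- its `L¹` norm.
      refine ⟨{[]}, ⟨∫ x, ‖h x‖ ∂μ, integral_nonneg fun x => norm_nonneg _⟩, fun φ M hM hφ => ?_⟩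
      have hφ' : ∀ x, ‖φ.1 x‖ ≤ M := hφ [] (by simp)
      calc ‖∫ x, h x * φ.1 x ∂μ‖ ≤ ∫ x, ‖h x * φ.1 x‖ ∂μ := norm_integral_le_integral_norm _
        _ ≤ ∫ x, ‖h x‖ * M ∂μ := by
            refine integral_mono
              (integrable_of_continuous μ (hh.mul φ.2.continuous)).norm
              ((integrable_of_continuous μ hh).norm.mul_const M) fun x => ?_
            simp only [norm_mul]
            gcongr
            exact hφ' x
        _ = (∫ x, ‖h x‖ ∂μ) * M := integral_mul_const _ _⟩

lemma groupFourierCoeff_densityDistribution (h : G → ℂ) (hh : Continuous h)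
    (ξ : UnitaryIrrep n G) (i j : Fin ξ.dim) :
    groupFourierCoeff (densityDistribution μ h hh) ξ i j =
      ∫ x, h x * star (ξ.toHom x j i) ∂μ := rfl

end Density

lemma not_equivalent_rep {ξ η : UnitaryDual n G} (h : ξ ≠ η) : ¬ ξ.rep.Equivalent η.rep := by
  intro h'
  apply h
  have := Quotient.sound (s := irrepSetoid n G) h'
  exact (Quotient.out_eq (s := irrepSetoid n G) ξ).symm.trans
    (this.trans (Quotient.out_eq (s := irrepSetoid n G) η))

lemma groupFourierCoeff_add (f g : distributions n G) (ξ : UnitaryIrrep n G) :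
    groupFourierCoeff (f + g) ξ = groupFourierCoeff f ξ + groupFourierCoeff g ξ := rfl

lemma groupFourierCoeff_sub (f g : distributions n G) (ξ : UnitaryIrrep n G) :
    groupFourierCoeff (f - g) ξ = groupFourierCoeff f ξ - groupFourierCoeff g ξ := rfl

/-- `groupFourierCoeff` at a fixed representation, as an additive map. -/
def groupFourierCoeffHom (ξ : UnitaryIrrep n G) :
    distributions n G →+ Matrix (Fin ξ.dim) (Fin ξ.dim) ℂ where
  toFun f := groupFourierCoeff f ξ
  map_zero' := rfl
  map_add' f g := groupFourierCoeff_add f g ξ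

lemma exists_leftInvariant_probability [CompactSpace G] [IsTopologicalGroup G]
    [MeasurableSpace G] [BorelSpace G] :
    ∃ μ : Measure G, IsProbabilityMeasure μ ∧ μ.IsMulLeftInvariant ∧ μ.IsOpenPosMeasure :=
  ⟨Measure.haarMeasure ⊤, ⟨Measure.haarMeasure_self⟩, inferInstance, inferInstance⟩

/-- The density is `d_ξ Tr(A ξ(x))`, the one-term Fourier inversion formula; Schur orthogonality
reads off its coefficients. -/
lemma exists_groupFourierCoeff_eq [CompactSpace G] [IsTopologicalGroup G]
    (ξ : UnitaryDual n G) (A : Matrix (Fin ξ.rep.dim) (Fin ξ.rep.dim) ℂ) :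
    ∃ g : distributions n G, groupFourierCoeff g ξ.rep = A ∧
      ∀ η, η ≠ ξ → groupFourierCoeff g η.rep = 0 := by
  let _ : MeasurableSpace G := borel G
  have : BorelSpace G := ⟨rfl⟩
  obtain ⟨μ, h1, h2, h3⟩ := exists_leftInvariant_probability (G := G)
  set h : G → ℂ := fun x => ∑ k, ∑ l, (ξ.rep.dim * A k l) * ξ.rep.toHom x l k with hh
  have hc : Continuous h := continuous_finsetSum _ fun k _ => continuous_finsetSum _ fun l _ =>
    continuous_const.mul (ξ.rep.continuous_toHom_apply l k)
  have key : ∀ (η : UnitaryIrrep n G) (i j : Fin η.dim),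
      groupFourierCoeff (densityDistribution μ h hc) η i j =
      ∑ k, ∑ l, (ξ.rep.dim * A k l) *
        ∫ x, ξ.rep.toHom x l k * star (η.toHom x j i) ∂μ := by
    intro η i j
    rw [groupFourierCoeff_densityDistribution]
    simp only [hh, Finset.sum_mul, ← integral_const_mul]
    have hint : ∀ k l, Integrable (fun x => (ξ.rep.dim * A k l) *
        (ξ.rep.toHom x l k * star (η.toHom x j i))) μ := fun k l =>
      (UnitaryIrrep.integrable_coeff_mul μ ξ.rep η l k j i).const_mul _
    simp only [mul_assoc] at hint ⊢
    rw [integral_finsetSum _ fun k _ => integrable_finsetSum _ fun l _ => hint k l]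
    refine Finset.sum_congr rfl fun k _ => ?_
    rw [integral_finsetSum _ fun l _ => hint k l]
  refine ⟨densityDistribution μ h hc, ?_, fun η hη => ?_⟩
  · ext i j
    rw [key]
    have hd : (ξ.rep.dim : ℂ) ≠ 0 := by exact_mod_cast ξ.rep.dim_pos.ne'
    simp only [UnitaryIrrep.integral_coeff_self]
    rw [Finset.sum_eq_single i, Finset.sum_eq_single j]
    · simp only [and_self, if_true]
      rw [mul_comm, inv_mul_cancel_left₀ hd]
    · intro b _ hb
      simp [hb]
    · simp
    · intro b _ hb
      simp [hb]
    · simp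
  · ext i j
    rw [key]
    simp_rw [UnitaryIrrep.integral_coeff_of_not_equivalent μ (not_equivalent_rep hη)]
    simp

lemma exists_groupFourierCoeff_eq_on_finset [CompactSpace G] [IsTopologicalGroup G]
    (F : Finset (UnitaryDual n G)) (f : distributions n G) :
    ∃ g : distributions n G, (∀ ξ ∈ F, groupFourierCoeff g ξ.rep = groupFourierCoeff f ξ.rep) ∧
      ∀ ξ ∉ F, groupFourierCoeff g ξ.rep = 0 := by
  classical
  choose g hg hg' using fun ξ : UnitaryDual n G =>
    exists_groupFourierCoeff_eq ξ (groupFourierCoeff f ξ.rep)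
  have hsum : ∀ η : UnitaryDual n G, groupFourierCoeff (∑ ξ ∈ F, g ξ) η.rep =
      ∑ ξ ∈ F, groupFourierCoeff (g ξ) η.rep := fun η =>
    map_sum (groupFourierCoeffHom η.rep) g F
  refine ⟨∑ ξ ∈ F, g ξ, fun η hη => ?_, fun η hη => ?_⟩
  · rw [hsum, Finset.sum_eq_single η (fun ξ _ h => hg' ξ η h.symm) (fun h => absurd hη h), hg]
  · rw [hsum]
    exact Finset.sum_eq_zero fun ξ hξ => hg' ξ η fun h => hη (h ▸ hξ)

end Schur

/-! ### Manifold derivatives of scalar functions in charts -/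

section Infinitesimal

variable {n : ℕ} {G : Type*} [TopologicalSpace G] [ChartedSpace (EuclideanSpace ℝ (Fin n)) G]

/-- The manifold derivative of a scalar function, as a linear map on the model space. -/
def scalarDeriv (f : G → ℂ) (x : G) : EuclideanSpace ℝ (Fin n) →L[ℝ] ℂ :=
  mfderiv (𝓡 n) 𝓘(ℝ, ℂ) f x

/-- The manifold derivative of a self-map, as a linear map on the model space. -/
def selfDeriv (a : G → G) (x : G) : EuclideanSpace ℝ (Fin n) →L[ℝ] EuclideanSpace ℝ (Fin n) :=
  mfderiv (𝓡 n) (𝓡 n) a x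

/-- The model has no boundary, so the derivative within the range of the model is an ordinary
Fréchet derivative and the calculus of normed spaces applies. -/
lemma hasMFDerivAt_iff_hasFDerivAt_comp_extChartAt_symm {f : G → ℂ} {x : G}
    {L : EuclideanSpace ℝ (Fin n) →L[ℝ] ℂ} :
    HasMFDerivAt (𝓡 n) 𝓘(ℝ, ℂ) f x L ↔ ContinuousAt f x ∧
      HasFDerivAt (fun y => f ((extChartAt (𝓡 n) x).symm y)) L (extChartAt (𝓡 n) x x) := by
  constructor
  · intro h
    refine ⟨h.1, HasFDerivWithinAt.hasFDerivAt h.2 ?_⟩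
    rw [ModelWithCorners.range_eq_univ]
    exact Filter.univ_mem
  · rintro ⟨h1, h2⟩
    exact ⟨h1, h2.hasFDerivWithinAt⟩

lemma hasFDerivAt_comp_extChartAt_symm {f : G → ℂ} {x : G}
    (hf : MDifferentiableAt (𝓡 n) 𝓘(ℝ, ℂ) f x) :
    HasFDerivAt (fun y => f ((extChartAt (𝓡 n) x).symm y)) (scalarDeriv f x)
      (extChartAt (𝓡 n) x x) :=
  (hasMFDerivAt_iff_hasFDerivAt_comp_extChartAt_symm.1 hf.hasMFDerivAt).2

lemma scalarDeriv_sum_mul {ι : Type*} [Fintype ι] (c : ι → ℂ) (f : ι → G → ℂ) (x : G)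
    (hf : ∀ k, MDifferentiableAt (𝓡 n) 𝓘(ℝ, ℂ) (f k) x) :
    (scalarDeriv (fun y => ∑ k, c k * f k y) x : EuclideanSpace ℝ (Fin n) →L[ℝ] ℂ) =
      ∑ k, c k • scalarDeriv (f k) x :=
  HasMFDerivAt.mfderiv (hasMFDerivAt_iff_hasFDerivAt_comp_extChartAt_symm.2
    ⟨tendsto_finsetSum _ fun k _ => (hf k).continuousAt.const_mul (c k),
      HasFDerivAt.fun_sum fun k _ => (hasFDerivAt_comp_extChartAt_symm (hf k)).const_mul (c k)⟩)

/-- The chain rule, with the base point of the outer derivative known up to an equality. -/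
lemma scalarDeriv_comp_of_eq {φ : G → ℂ} {a : G → G} {x z : G}
    (hφ : MDifferentiable (𝓡 n) 𝓘(ℝ, ℂ) φ) (ha : MDifferentiableAt (𝓡 n) (𝓡 n) a x)
    (hz : a x = z) :
    (scalarDeriv (fun y => φ (a y)) x : EuclideanSpace ℝ (Fin n) →L[ℝ] ℂ) =
      (scalarDeriv φ z).comp (selfDeriv a x) := by
  subst hz
  exact ((hφ (a x)).hasMFDerivAt.comp x ha.hasMFDerivAt).mfderiv

lemma leftDeriv_sum_mul [Group G] {ι : Type*} [Fintype ι] (c : ι → ℂ) (f : ι → G → ℂ)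
    (hf : ∀ k, MDifferentiable (𝓡 n) 𝓘(ℝ, ℂ) (f k)) (v : GroupLieAlgebra (𝓡 n) G) (x : G) :
    leftDeriv v (fun y => ∑ k, c k * f k y) x = ∑ k, c k * leftDeriv v (f k) x := by
  have h := DFunLike.congr_fun (scalarDeriv_sum_mul c f x fun k => hf k x)
    (show EuclideanSpace ℝ (Fin n) from mulInvariantVectorField v x)
  rw [sum_apply] at h
  exact h

end Infinitesimal

/-! ### The Lie algebra representation, the Casimir matrix and `⟨ξ⟩` -/

namespace UnitaryIrrep

variable {n : ℕ} {G : Type*} [Group G] [TopologicalSpace G]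
  [ChartedSpace (EuclideanSpace ℝ (Fin n)) G]

lemma mdifferentiable_toHom (ξ : UnitaryIrrep n G) (i j : Fin ξ.dim) :
    MDifferentiable (𝓡 n) 𝓘(ℝ, ℂ) fun x => ξ.toHom x i j :=
  (ξ.smooth i j).mdifferentiable (by simp)

/-- The representation of the Lie algebra induced by `ξ`. -/
def differential (ξ : UnitaryIrrep n G) :
    GroupLieAlgebra (𝓡 n) G →ₗ[ℝ] Matrix (Fin ξ.dim) (Fin ξ.dim) ℂ where
  toFun v := Matrix.of fun i j => mfderiv (𝓡 n) 𝓘(ℝ, ℂ) (fun x => ξ.toHom x i j) 1 v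
  map_add' v w := by
    ext i j
    exact map_add (mfderiv (𝓡 n) 𝓘(ℝ, ℂ) (fun x => ξ.toHom x i j) 1) v w
  map_smul' c v := by
    ext i j
    exact map_smul (mfderiv (𝓡 n) 𝓘(ℝ, ℂ) (fun x => ξ.toHom x i j) 1) c v

lemma differential_apply (ξ : UnitaryIrrep n G) (v : GroupLieAlgebra (𝓡 n) G)
    (i j : Fin ξ.dim) : ξ.differential v i j = scalarDeriv (fun x => ξ.toHom x i j) 1 v := rfl

/-- Differentiate `ξ(x)* ξ(x) = 1` at the identity. -/
lemma conjTranspose_differential (ξ : UnitaryIrrep n G) (v : GroupLieAlgebra (𝓡 n) G) :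
    (ξ.differential v).conjTranspose = -ξ.differential v := by
  have hLd := fun i j => hasFDerivAt_comp_extChartAt_symm (ξ.mdifferentiable_toHom i j 1)
  ext i j
  have h1 := HasFDerivAt.fun_sum (u := Finset.univ)
    fun k (_ : k ∈ (Finset.univ : Finset (Fin ξ.dim))) => ((hLd k i).star).mul (hLd k j)
  have h2 : (fun y => ∑ k, star (ξ.toHom ((extChartAt (𝓡 n) (1 : G)).symm y) k i) *
      ξ.toHom ((extChartAt (𝓡 n) (1 : G)).symm y) k j) =
      fun _ => (1 : Matrix (Fin ξ.dim) (Fin ξ.dim) ℂ) i j := by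
    ext y
    rw [← ξ.conjTranspose_mul_self ((extChartAt (𝓡 n) (1 : G)).symm y), Matrix.mul_apply]
    rfl
  have h3 := DFunLike.congr_fun (h1.unique (h2 ▸ hasFDerivAt_const _ _))
    (show EuclideanSpace ℝ (Fin n) from v)
  rw [sum_apply] at h3
  simp only [extChartAt_to_inv, map_one] at h3
  have h4 : ∑ k, ((1 : Matrix (Fin ξ.dim) (Fin ξ.dim) ℂ) k j * star (ξ.differential v k i) +
      star ((1 : Matrix (Fin ξ.dim) (Fin ξ.dim) ℂ) k i) * ξ.differential v k j) = 0 := by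
    refine Eq.trans ?_ (h3.trans rfl)
    refine Finset.sum_congr rfl fun k _ => ?_
    exact add_comm _ _
  simp only [Matrix.one_apply, Finset.sum_add_distrib, ite_mul, one_mul, zero_mul,
    Finset.sum_ite_eq', Finset.mem_univ, if_true, apply_ite star, star_one, star_zero] at h4
  rw [Matrix.conjTranspose_apply, Matrix.neg_apply]
  exact eq_neg_of_add_eq_zero_left h4

variable [LieGroup (𝓡 n) ∞ G]

/-- Differentiate `ξ(x y) = ξ(x) ξ(y)` in `y` at the identity. -/
lemma leftDeriv_coeff (ξ : UnitaryIrrep n G) (v : GroupLieAlgebra (𝓡 n) G) (i j : Fin ξ.dim)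
    (x : G) : leftDeriv v (fun y => ξ.toHom y i j) x = (ξ.toHom x * ξ.differential v) i j := by
  have h1 := scalarDeriv_comp_of_eq (a := fun y : G => x * y) (z := x)
    (ξ.mdifferentiable_toHom i j)
    ((contMDiff_mul_left (I := 𝓡 n) (n := ∞) (a := x)).mdifferentiable (by simp) 1)
    (mul_one x)
  have h2 : (fun y => ξ.toHom (x * y) i j) = fun y => ∑ k, ξ.toHom x i k * ξ.toHom y k j := by
    ext y
    rw [map_mul, Matrix.mul_apply]
  rw [h2, scalarDeriv_sum_mul _ _ _ fun k => ξ.mdifferentiable_toHom k j 1] at h1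
  have h3 := DFunLike.congr_fun h1 (show EuclideanSpace ℝ (Fin n) from v)
  rw [sum_apply] at h3
  rw [Matrix.mul_apply]
  exact h3.symm

lemma differential_adjointAction (ξ : UnitaryIrrep n G) (g : G) (v : GroupLieAlgebra (𝓡 n) G) :
    ξ.differential (adjointAction g v) =
      ξ.toHom g * ξ.differential v * (ξ.toHom g).conjTranspose := by
  ext i j
  have ha : ContMDiff (𝓡 n) (𝓡 n) ∞ fun y : G => g * y * g⁻¹ :=
    (contMDiff_mul_right (a := g⁻¹)).comp (contMDiff_mul_left (a := g))
  have h1 := scalarDeriv_comp_of_eq (a := fun y : G => g * y * g⁻¹) (z := 1)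
    (ξ.mdifferentiable_toHom i j) (ha.mdifferentiable (by simp) 1) (by simp)
  have h2 : (fun y => ξ.toHom (g * y * g⁻¹) i j) = fun y => ∑ p : Fin ξ.dim × Fin ξ.dim,
      (ξ.toHom g i p.2 * (ξ.toHom g).conjTranspose p.1 j) * ξ.toHom y p.2 p.1 := by
    ext y
    rw [map_mul, map_mul, toHom_inv, Matrix.mul_apply, Fintype.sum_prod_type]
    refine Finset.sum_congr rfl fun l _ => ?_
    rw [Matrix.mul_apply, Finset.sum_mul]
    exact Finset.sum_congr rfl fun k _ => by ring
  rw [h2, scalarDeriv_sum_mul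
    (fun p : Fin ξ.dim × Fin ξ.dim => ξ.toHom g i p.2 * (ξ.toHom g).conjTranspose p.1 j)
    (fun p y => ξ.toHom y p.2 p.1) 1 fun p => ξ.mdifferentiable_toHom p.2 p.1 1] at h1
  have h3 := DFunLike.congr_fun h1 (show EuclideanSpace ℝ (Fin n) from v)
  rw [sum_apply] at h3
  refine h3.symm.trans ?_
  rw [Matrix.mul_apply, Fintype.sum_prod_type]
  refine Finset.sum_congr rfl fun l _ => ?_
  rw [Matrix.mul_apply, Finset.sum_mul]
  refine Finset.sum_congr rfl fun k _ => ?_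
  rw [differential_apply, smul_apply, smul_eq_mul]
  ring

lemma laplacian_coeff (ξ : UnitaryIrrep n G)
    (X : Module.Basis (Fin n) ℝ (GroupLieAlgebra (𝓡 n) G)) (i j : Fin ξ.dim) (x : G) :
    laplacian X (fun y => ξ.toHom y i j) x =
      (ξ.toHom x * ∑ a, ξ.differential (X a) * ξ.differential (X a)) i j := by
  have h1 : ∀ a, leftDeriv (X a) (fun y => ξ.toHom y i j) =
      fun y => ∑ k, ξ.differential (X a) k j * ξ.toHom y i k := by
    intro a
    ext y
    rw [leftDeriv_coeff, Matrix.mul_apply]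
    simp only [mul_comm]
  simp only [laplacian, h1]
  rw [Matrix.mul_sum, Matrix.sum_apply]
  refine Finset.sum_congr rfl fun a _ => ?_
  rw [leftDeriv_sum_mul _ _ (fun k => ξ.mdifferentiable_toHom i k)]
  simp only [leftDeriv_coeff]
  rw [← Matrix.mul_assoc, Matrix.mul_apply]
  simp only [mul_comm]

/-- `Ad(g)` moves an orthonormal basis by an orthogonal matrix, which leaves the sum of squares
unchanged; on the other hand it conjugates each `dξ(X a)` by `ξ(g)`. -/
lemma casimir_commute (ξ : UnitaryIrrep n G) (B : InvariantInnerProduct n G)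
    (X : Module.Basis (Fin n) ℝ (GroupLieAlgebra (𝓡 n) G)) (hX : B.IsOrthonormalBasis X) (g : G) :
    (∑ a, ξ.differential (X a) * ξ.differential (X a)) * ξ.toHom g =
      ξ.toHom g * ∑ a, ξ.differential (X a) * ξ.differential (X a) := by
  set A : Matrix (Fin n) (Fin n) ℝ := Matrix.of fun i j => X.repr (adjointAction g (X i)) j
    with hA
  have hAd : ∀ i, adjointAction g (X i) = ∑ j, A i j • X j := fun i => (X.sum_repr _).symm
  have hAA : A * A.transpose = 1 := by
    ext i k
    have hX' : ∀ i j, B.form (X i) (X j) = if i = j then 1 else 0 := hX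
    have h := B.invariant g (X i) (X k)
    rw [hX, hAd, hAd] at h
    simp only [map_sum, map_smul, LinearMap.sum_apply, LinearMap.smul_apply, hX', smul_eq_mul,
      mul_ite, mul_one, mul_zero, Finset.sum_ite_eq', Finset.mem_univ,
      if_true] at h
    rw [Matrix.mul_apply, Matrix.one_apply, ← h]
    simp [mul_comm]
  -- Invariance gives orthonormal rows, whereas the sum over the basis needs orthonormal columns.
  have hAA' : A.transpose * A = 1 := mul_eq_one_comm.1 hAA
  have hC : ∑ a, ξ.differential (adjointAction g (X a)) * ξ.differential (adjointAction g (X a)) =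
      ∑ a, ξ.differential (X a) * ξ.differential (X a) := by
    simp only [hAd, map_sum, map_smul, Finset.sum_mul, Finset.mul_sum, Matrix.smul_mul,
      Matrix.mul_smul, smul_smul]
    rw [Finset.sum_comm]
    refine Finset.sum_congr rfl fun j _ => ?_
    rw [Finset.sum_comm]
    simp only [← Finset.sum_smul]
    have : ∀ k, ∑ a, A a j * A a k = if j = k then 1 else 0 := by
      intro k
      have := congrFun (congrFun hAA' j) k
      rw [Matrix.one_apply] at this
      rw [← this, Matrix.mul_apply]
      rfl
    simp [this]
  conv_lhs => rw [← hC]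
  simp only [differential_adjointAction, Finset.sum_mul, Finset.mul_sum]
  refine Finset.sum_congr rfl fun a _ => ?_
  have h1 := ξ.conjTranspose_mul_self g
  calc _ = ξ.toHom g * ξ.differential (X a) * ((ξ.toHom g).conjTranspose * ξ.toHom g) *
        ξ.differential (X a) * ((ξ.toHom g).conjTranspose * ξ.toHom g) := by
        simp only [Matrix.mul_assoc]
    _ = _ := by rw [h1]; simp only [Matrix.mul_assoc, Matrix.mul_one]

/-- The Casimir eigenvalue and its relation with the entries of the differential. -/
lemma exists_casimir_eq (ξ : UnitaryIrrep n G) (B : InvariantInnerProduct n G)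
    (X : Module.Basis (Fin n) ℝ (GroupLieAlgebra (𝓡 n) G)) (hX : B.IsOrthonormalBasis X) :
    ∃ c : ℝ, 0 ≤ c ∧ ∑ a, ξ.differential (X a) * ξ.differential (X a) = (-c : ℂ) • 1 ∧
      ∀ k, ∑ a, ∑ l, ‖ξ.differential (X a) l k‖ ^ 2 = c := by
  obtain ⟨z, hz⟩ := ξ.eq_smul_one_of_commute _ (ξ.casimir_commute B X hX)
  have hk : ∀ k, ((∑ a, ∑ l, ‖ξ.differential (X a) l k‖ ^ 2 : ℝ) : ℂ) = -z := by
    intro k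
    have h1 : ∑ a, (ξ.differential (X a)).conjTranspose * ξ.differential (X a) = -(z • 1) := by
      simp only [conjTranspose_differential, Matrix.neg_mul, Finset.sum_neg_distrib, hz]
    have h2 := congrFun (congrFun h1 k) k
    simp only [Matrix.sum_apply, Matrix.mul_apply, Matrix.conjTranspose_apply, Matrix.neg_apply,
      Matrix.smul_apply, Matrix.one_apply_eq, smul_eq_mul, mul_one] at h2
    rw [← h2]
    push_cast
    refine Finset.sum_congr rfl fun a _ => Finset.sum_congr rfl fun l _ => ?_
    rw [RCLike.star_def, Complex.conj_mul']
  let k₀ : Fin ξ.dim := ⟨0, ξ.dim_pos⟩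
  refine ⟨∑ a, ∑ l, ‖ξ.differential (X a) l k₀‖ ^ 2, by positivity, ?_, fun k => ?_⟩
  · rw [hk, neg_neg, hz]
  · have := (hk k).trans (hk k₀).symm
    exact_mod_cast this

/-- The choice defining `bracket` is not vacuous: `√(1 + c)`, with `-c` the Casimir scalar, is a
valid value. -/
lemma bracket_spec (ξ : UnitaryIrrep n G) (B : InvariantInnerProduct n G)
    (X : Module.Basis (Fin n) ℝ (GroupLieAlgebra (𝓡 n) G)) (hX : B.IsOrthonormalBasis X) :
    0 ≤ ξ.bracket X ∧ ∀ i j x, ξ.toHom x i j - laplacian X (fun y => ξ.toHom y i j) x =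
      (ξ.bracket X : ℂ) ^ 2 * ξ.toHom x i j := by
  obtain ⟨c, hc, hC, -⟩ := ξ.exists_casimir_eq B X hX
  refine Classical.epsilon_spec (p := fun μ : ℝ => 0 ≤ μ ∧ ∀ i j x,
    ξ.toHom x i j - laplacian X (fun y => ξ.toHom y i j) x = (μ : ℂ) ^ 2 * ξ.toHom x i j)
    ⟨√(1 + c), Real.sqrt_nonneg _, fun i j x => ?_⟩
  rw [laplacian_coeff, hC, ← Complex.ofReal_pow, Real.sq_sqrt (by linarith)]
  simp only [neg_smul, Matrix.mul_neg, Matrix.mul_smul, Matrix.mul_one, Matrix.neg_apply,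
    Matrix.smul_apply, smul_eq_mul]
  push_cast
  ring

/-- The bound is per column and free of `d_ξ`, which makes the later estimates uniform over
representations of all dimensions. -/
lemma sum_norm_sq_differential (ξ : UnitaryIrrep n G) (B : InvariantInnerProduct n G)
    (X : Module.Basis (Fin n) ℝ (GroupLieAlgebra (𝓡 n) G)) (hX : B.IsOrthonormalBasis X)
    (k : Fin ξ.dim) :
    ∑ a, ∑ l, ‖ξ.differential (X a) l k‖ ^ 2 = ξ.bracket X ^ 2 - 1 := by
  obtain ⟨c, hc, hC, hk⟩ := ξ.exists_casimir_eq B X hX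
  have h := (ξ.bracket_spec B X hX).2 k k 1
  rw [laplacian_coeff, hC] at h
  simp only [map_one, Matrix.one_apply_eq, neg_smul, Matrix.mul_neg, Matrix.mul_smul,
    Matrix.neg_apply, Matrix.smul_apply, smul_eq_mul, mul_one] at h
  rw [hk]
  have : (1 : ℝ) + c = ξ.bracket X ^ 2 := by
    apply Complex.ofReal_injective
    push_cast
    rw [← h]; ring
  linarith

lemma bracket_eq_one_of_dim_zero {G : Type*} [Group G] [TopologicalSpace G]
    [ChartedSpace (EuclideanSpace ℝ (Fin 0)) G] [LieGroup (𝓡 0) ∞ G]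
    (ξ : UnitaryIrrep 0 G) (B : InvariantInnerProduct 0 G)
    (X : Module.Basis (Fin 0) ℝ (GroupLieAlgebra (𝓡 0) G)) (hX : B.IsOrthonormalBasis X) :
    ξ.bracket X = 1 := by
  have h := ξ.sum_norm_sq_differential B X hX ⟨0, ξ.dim_pos⟩
  simp only [Finset.univ_eq_empty, Finset.sum_empty] at h
  have h0 := (ξ.bracket_spec B X hX).1
  nlinarith

end UnitaryIrrep

/-! ### Uniform control of coefficients near the identity -/

section LocalTranslation

variable {n : ℕ} {G : Type*} [Group G] [TopologicalSpace G]
  [ChartedSpace (EuclideanSpace ℝ (Fin n)) G]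

variable (n G) in
/-- The map `(z, y) ↦ z⁻¹ y` read in the chart at the identity. -/
def chartDiv (p : EuclideanSpace ℝ (Fin n) × EuclideanSpace ℝ (Fin n)) :
    EuclideanSpace ℝ (Fin n) :=
  extChartAt (𝓡 n) (1 : G) (((extChartAt (𝓡 n) (1 : G)).symm p.1)⁻¹ *
    (extChartAt (𝓡 n) (1 : G)).symm p.2)

lemma chartDiv_self (z : EuclideanSpace ℝ (Fin n)) :
    chartDiv n G (z, z) = extChartAt (𝓡 n) (1 : G) 1 := by
  simp [chartDiv]

variable [LieGroup (𝓡 n) ∞ G]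

lemma contDiffAt_chartDiv {z : EuclideanSpace ℝ (Fin n)}
    (hz : z ∈ (extChartAt (𝓡 n) (1 : G)).target) : ContDiffAt ℝ 1 (chartDiv n G) (z, z) := by
  rw [← contMDiffAt_iff_contDiffAt]
  have hs : ContMDiffAt 𝓘(ℝ, EuclideanSpace ℝ (Fin n)) (𝓡 n) ∞
      (extChartAt (𝓡 n) (1 : G)).symm z :=
    (contMDiffOn_extChartAt_symm (I := 𝓡 n) (n := ∞) (1 : G)).contMDiffAt
      ((isOpen_extChartAt_target (I := 𝓡 n) (1 : G)).mem_nhds hz)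
  have h1 : ContMDiffAt 𝓘(ℝ, EuclideanSpace ℝ (Fin n) × EuclideanSpace ℝ (Fin n)) (𝓡 n) ∞
      (fun p => (extChartAt (𝓡 n) (1 : G)).symm p.1) (z, z) :=
    ContMDiffAt.comp (z, z) (g := (extChartAt (𝓡 n) (1 : G)).symm) (f := Prod.fst) hs
      contDiff_fst.contMDiff.contMDiffAt
  have h2 : ContMDiffAt 𝓘(ℝ, EuclideanSpace ℝ (Fin n) × EuclideanSpace ℝ (Fin n)) (𝓡 n) ∞
      (fun p => (extChartAt (𝓡 n) (1 : G)).symm p.2) (z, z) :=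
    ContMDiffAt.comp (z, z) (g := (extChartAt (𝓡 n) (1 : G)).symm) (f := Prod.snd) hs
      contDiff_snd.contMDiff.contMDiffAt
  have h3 := h1.inv.mul h2
  have h4 : ContMDiffAt (𝓡 n) 𝓘(ℝ, EuclideanSpace ℝ (Fin n)) ∞ (extChartAt (𝓡 n) (1 : G))
      (((extChartAt (𝓡 n) (1 : G)).symm z)⁻¹ * (extChartAt (𝓡 n) (1 : G)).symm z) := by
    rw [inv_mul_cancel]
    exact contMDiffAt_extChartAt
  exact (ContMDiffAt.comp (z, z) (g := extChartAt (𝓡 n) (1 : G)) h4 h3).of_le (by simp)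

lemma eventually_symm_eq_mul_symm_chartDiv {z : EuclideanSpace ℝ (Fin n)}
    (hz : z ∈ (extChartAt (𝓡 n) (1 : G)).target) :
    ∀ᶠ y in nhds z, (extChartAt (𝓡 n) (1 : G)).symm y =
      (extChartAt (𝓡 n) (1 : G)).symm z *
        (extChartAt (𝓡 n) (1 : G)).symm (chartDiv n G (z, y)) := by
  have : IsTopologicalGroup G := topologicalGroup_of_lieGroup (𝓡 n) ∞
  have hc : ContinuousAt (fun y => ((extChartAt (𝓡 n) (1 : G)).symm z)⁻¹ *
      (extChartAt (𝓡 n) (1 : G)).symm y) z :=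
    continuousAt_const.mul (continuousAt_extChartAt_symm'' hz)
  have hs : (extChartAt (𝓡 n) (1 : G)).source ∈ nhds (((extChartAt (𝓡 n) (1 : G)).symm z)⁻¹ *
      (extChartAt (𝓡 n) (1 : G)).symm z) := by
    rw [inv_mul_cancel]
    exact extChartAt_source_mem_nhds (I := 𝓡 n) (1 : G)
  filter_upwards [hc hs] with y hy
  rw [chartDiv, (extChartAt (𝓡 n) (1 : G)).left_inv hy, mul_inv_cancel_left]

variable (n G) in
/-- In a ball around the identity, the derivative of `y ↦ z⁻¹ y` at `y = z`, read in the chart at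
the identity, is uniformly bounded. -/
lemma exists_norm_fderiv_chartDiv_le : ∃ K : ℝ≥0, ∃ r > 0,
    ∀ z ∈ Metric.ball (extChartAt (𝓡 n) (1 : G) 1) r, z ∈ (extChartAt (𝓡 n) (1 : G)).target ∧
      ∃ L : EuclideanSpace ℝ (Fin n) →L[ℝ] EuclideanSpace ℝ (Fin n), ‖L‖ ≤ K ∧
        HasFDerivAt (fun y => chartDiv n G (z, y)) L z := by
  set p := extChartAt (𝓡 n) (1 : G) 1 with hp
  have hpt : p ∈ (extChartAt (𝓡 n) (1 : G)).target := mem_extChartAt_target (I := 𝓡 n) (1 : G)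
  -- A `C¹` map is Lipschitz near `(p, p)`, and a Lipschitz constant bounds the partial derivative
  -- at every nearby `z`.
  obtain ⟨K, t, ht, hK⟩ := (contDiffAt_chartDiv hpt).exists_lipschitzOnWith
  obtain ⟨r₁, hr₁, ht₁⟩ := Metric.mem_nhds_iff.1 ht
  obtain ⟨r₂, hr₂, ht₂⟩ := Metric.mem_nhds_iff.1
    ((isOpen_extChartAt_target (I := 𝓡 n) (1 : G)).mem_nhds hpt)
  refine ⟨K, min r₁ r₂, lt_min hr₁ hr₂, fun z hz => ?_⟩
  have hzt := ht₂ (Metric.ball_subset_ball (min_le_right _ _) hz)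
  refine ⟨hzt, fderiv ℝ (fun y => chartDiv n G (z, y)) z, ?_, ?_⟩
  · refine norm_fderiv_le_of_lipschitzOn ℝ (s := Metric.ball p r₁)
      (Metric.isOpen_ball.mem_nhds (Metric.ball_subset_ball (min_le_left _ _) hz)) ?_
    intro y hy y' hy'
    have hz₁ := Metric.ball_subset_ball (min_le_left r₁ r₂) hz
    have hmem : ∀ w ∈ Metric.ball p r₁, (z, w) ∈ t := fun w hw => ht₁ (by
      rw [← ball_prod_same]; exact ⟨hz₁, hw⟩)
    refine (hK (hmem y hy) (hmem y' hy')).trans (le_of_eq ?_)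
    rw [Prod.edist_eq]
    simp
  · refine DifferentiableAt.hasFDerivAt ?_
    exact ((contDiffAt_chartDiv hzt).differentiableAt (by simp)).comp z
      ((differentiableAt_const z).prodMk differentiableAt_id)

end LocalTranslation

namespace UnitaryIrrep

variable {n : ℕ} {G : Type*} [Group G] [TopologicalSpace G]
  [ChartedSpace (EuclideanSpace ℝ (Fin n)) G]

lemma sum_norm_sq_row (ξ : UnitaryIrrep n G) (x : G) (k : Fin ξ.dim) :
    ∑ l, ‖ξ.toHom x k l‖ ^ 2 = 1 := by
  have h := congrFun (congrFun (ξ.self_mul_conjTranspose x) k) k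
  rw [Matrix.mul_apply, Matrix.one_apply_eq] at h
  apply Complex.ofReal_injective
  push_cast
  rw [← h]
  refine Finset.sum_congr rfl fun l _ => ?_
  rw [Matrix.conjTranspose_apply, RCLike.star_def, Complex.mul_conj']

variable [LieGroup (𝓡 n) ∞ G]

/-- Matrix entries of `ξ(x) dξ(w)` are bounded by `⟨ξ⟩ ‖w‖`, uniformly in `ξ`. -/
lemma exists_norm_mul_differential_le (B : InvariantInnerProduct n G)
    (X : Module.Basis (Fin n) ℝ (GroupLieAlgebra (𝓡 n) G)) (hX : B.IsOrthonormalBasis X) :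
    ∃ M : ℝ, 0 ≤ M ∧ ∀ (ξ : UnitaryIrrep n G) (x : G) (w : EuclideanSpace ℝ (Fin n))
      (k : Fin ξ.dim),
      ‖∑ l, ξ.toHom x k l * ξ.differential w l k‖ ≤ M * ξ.bracket X * ‖w‖ := by
  let c : Fin n → (EuclideanSpace ℝ (Fin n) →L[ℝ] ℝ) := fun a =>
    LinearMap.toContinuousLinearMap (show EuclideanSpace ℝ (Fin n) →ₗ[ℝ] ℝ from X.coord a)
  have hc : ∀ a (w : EuclideanSpace ℝ (Fin n)), X.repr w a = c a w := fun a w => rfl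
  refine ⟨∑ a, ‖c a‖, by positivity, fun ξ x w k => ?_⟩
  have hμ := (ξ.bracket_spec B X hX).1
  have hcol : ∀ a, ∑ l, ‖ξ.differential (X a) l k‖ ^ 2 ≤ ξ.bracket X ^ 2 := by
    intro a
    have h1 := ξ.sum_norm_sq_differential B X hX k
    have h2 := Finset.single_le_sum (f := fun a => ∑ l, ‖ξ.differential (X a) l k‖ ^ 2)
      (fun a _ => by positivity) (Finset.mem_univ a)
    exact h2.trans (by linarith)
  -- Cauchy–Schwarz between a unit row of `ξ(x)` and a column of `dξ(X a)`.
  have hrow : ∀ a, ‖∑ l, ξ.toHom x k l * ξ.differential (X a) l k‖ ≤ ξ.bracket X := by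
    intro a
    refine abs_le_of_sq_le_sq' ?_ hμ |>.2
    calc ‖∑ l, ξ.toHom x k l * ξ.differential (X a) l k‖ ^ 2
        ≤ (∑ l, ‖ξ.toHom x k l‖ * ‖ξ.differential (X a) l k‖) ^ 2 := by
          gcongr
          refine (norm_sum_le _ _).trans (le_of_eq ?_)
          simp only [norm_mul]
      _ ≤ (∑ l, ‖ξ.toHom x k l‖ ^ 2) * ∑ l, ‖ξ.differential (X a) l k‖ ^ 2 :=
          Finset.sum_mul_sq_le_sq_mul_sq _ _ _
      _ ≤ _ := by rw [sum_norm_sq_row, one_mul]; exact hcol a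
  have hw : ξ.differential w = ∑ a, c a w • ξ.differential (X a) := by
    conv_lhs => rw [← X.sum_repr w]
    simp only [map_sum, map_smul, hc]
  calc ‖∑ l, ξ.toHom x k l * ξ.differential w l k‖
      = ‖∑ a, c a w • ∑ l, ξ.toHom x k l * ξ.differential (X a) l k‖ := by
        rw [hw]
        simp only [Matrix.sum_apply, Matrix.smul_apply, Finset.mul_sum, Finset.smul_sum,
          mul_smul_comm]
        rw [Finset.sum_comm]
    _ ≤ ∑ a, ‖c a‖ * ‖w‖ * ξ.bracket X := by
        refine (norm_sum_le _ _).trans (Finset.sum_le_sum fun a _ => ?_)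
        rw [norm_smul]
        gcongr
        · exact (c a).le_opNorm w
        · exact hrow a
    _ = _ := by
        rw [Finset.sum_mul, Finset.sum_mul]
        exact Finset.sum_congr rfl fun a _ => by ring

/-- Near `z`, writing `y = z (z⁻¹ y)` transports the derivative to the identity, where it is the
differential of `ξ`. -/
lemma hasFDerivAt_coeff_comp_symm (ξ : UnitaryIrrep n G) (i j : Fin ξ.dim)
    {z : EuclideanSpace ℝ (Fin n)} (hz : z ∈ (extChartAt (𝓡 n) (1 : G)).target)
    {L : EuclideanSpace ℝ (Fin n) →L[ℝ] EuclideanSpace ℝ (Fin n)}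
    (hL : HasFDerivAt (fun y => chartDiv n G (z, y)) L z) :
    HasFDerivAt (fun y => ξ.toHom ((extChartAt (𝓡 n) (1 : G)).symm y) i j)
      (∑ l, ξ.toHom ((extChartAt (𝓡 n) (1 : G)).symm z) i l •
        (scalarDeriv (fun x => ξ.toHom x l j) 1).comp L) z := by
  have h1 : HasFDerivAt (fun y => ∑ l, ξ.toHom ((extChartAt (𝓡 n) (1 : G)).symm z) i l *
      ξ.toHom ((extChartAt (𝓡 n) (1 : G)).symm (chartDiv n G (z, y))) l j)
      (∑ l, ξ.toHom ((extChartAt (𝓡 n) (1 : G)).symm z) i l •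
        (scalarDeriv (fun x => ξ.toHom x l j) 1).comp L) z := by
    refine HasFDerivAt.fun_sum fun l _ => HasFDerivAt.const_mul ?_ _
    have h := hasFDerivAt_comp_extChartAt_symm (ξ.mdifferentiable_toHom l j 1)
    rw [← chartDiv_self (G := G) z] at h
    exact HasFDerivAt.comp z h hL
  refine h1.congr_of_eventuallyEq ?_
  filter_upwards [eventually_symm_eq_mul_symm_chartDiv hz] with y hy
  rw [hy, map_mul, Matrix.mul_apply]

/-- On a neighbourhood of the identity, the diagonal entries of all representations of bounded
Laplace eigenvalue are close to `1`. -/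
lemma exists_nhds_one_norm_sub_one_le (B : InvariantInnerProduct n G)
    (X : Module.Basis (Fin n) ℝ (GroupLieAlgebra (𝓡 n) G)) (hX : B.IsOrthonormalBasis X)
    (R : ℝ) : ∃ U ∈ nhds (1 : G), ∀ ξ : UnitaryIrrep n G, ξ.bracket X ≤ R →
      ∀ x ∈ U, ∀ k, ‖ξ.toHom x k k - 1‖ ≤ 1 / 2 := by
  obtain ⟨M, hM, hMle⟩ := exists_norm_mul_differential_le B X hX
  obtain ⟨K, r, hr, hK⟩ := exists_norm_fderiv_chartDiv_le n G
  set p := extChartAt (𝓡 n) (1 : G) 1 with hp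
  set Q : ℝ := M * |R| * K with hQ
  have hQ0 : 0 ≤ Q := by positivity
  -- Chosen so that `Q δ ≤ 1/2` in the mean value inequality; the `+ 1` covers `Q = 0`.
  set δ := min r (1 / (2 * (Q + 1))) with hδ
  have hδ0 : 0 < δ := lt_min hr (by positivity)
  refine ⟨(extChartAt (𝓡 n) (1 : G)).source ∩
    extChartAt (𝓡 n) (1 : G) ⁻¹' Metric.ball p δ, ?_, ?_⟩
  · exact Filter.inter_mem (extChartAt_source_mem_nhds (I := 𝓡 n) (1 : G))
      ((continuousAt_extChartAt (I := 𝓡 n) (1 : G)).preimage_mem_nhds (Metric.ball_mem_nhds _ hδ0))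
  · rintro ξ hξ x ⟨hxs, hxb⟩ k
    have hder : ∀ z ∈ Metric.ball p δ, ∃ L' : EuclideanSpace ℝ (Fin n) →L[ℝ] ℂ, ‖L'‖ ≤ Q ∧
        HasFDerivAt (fun y => ξ.toHom ((extChartAt (𝓡 n) (1 : G)).symm y) k k) L' z := by
      intro z hz
      obtain ⟨hzt, L, hLK, hL⟩ := hK z (Metric.ball_subset_ball (min_le_left _ _) hz)
      refine ⟨_, ?_, ξ.hasFDerivAt_coeff_comp_symm k k hzt hL⟩
      refine ContinuousLinearMap.opNorm_le_bound _ hQ0 fun w => ?_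
      have h1 := hMle ξ ((extChartAt (𝓡 n) (1 : G)).symm z) (L w) k
      have h2 : (∑ l, ξ.toHom ((extChartAt (𝓡 n) (1 : G)).symm z) k l •
          (scalarDeriv (fun x => ξ.toHom x l k) 1).comp L) w =
          ∑ l, ξ.toHom ((extChartAt (𝓡 n) (1 : G)).symm z) k l *
            ξ.differential (show EuclideanSpace ℝ (Fin n) from L w) l k := by
        rw [sum_apply]
        rfl
      rw [h2]
      refine h1.trans ?_
      calc M * ξ.bracket X * ‖L w‖ ≤ M * |R| * (K * ‖w‖) := by
            gcongr
            · exact hξ.trans (le_abs_self R)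
            · exact L.le_of_opNorm_le hLK w
        _ = Q * ‖w‖ := by rw [hQ]; ring
    choose! L' hL'Q hL' using hder
    have hmv := (convex_ball p δ).norm_image_sub_le_of_norm_hasFDerivWithin_le
      (fun z hz => (hL' z hz).hasFDerivWithinAt) hL'Q (Metric.mem_ball_self hδ0) hxb
    rw [(extChartAt (𝓡 n) (1 : G)).left_inv hxs, hp, extChartAt_to_inv, map_one,
      Matrix.one_apply_eq] at hmv
    refine hmv.trans ?_
    have hd : ‖extChartAt (𝓡 n) (1 : G) x - p‖ ≤ 1 / (2 * (Q + 1)) := by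
      rw [← dist_eq_norm]
      exact (Metric.mem_ball.1 hxb).le.trans (min_le_right _ _)
    calc Q * ‖extChartAt (𝓡 n) (1 : G) x - p‖ ≤ Q * (1 / (2 * (Q + 1))) := by gcongr
      _ ≤ 1 / 2 := by
          rw [mul_one_div, div_le_div_iff₀ (by positivity) (by positivity)]
          linarith

end UnitaryIrrep

/-! ### Counting representations by orthonormality of characters -/

section Finiteness

variable {n : ℕ} {G : Type*} [Group G] [TopologicalSpace G]
  [ChartedSpace (EuclideanSpace ℝ (Fin n)) G] [CompactSpace G] [MeasurableSpace G] [BorelSpace G]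
  (μ : Measure G) [IsProbabilityMeasure μ] [μ.IsMulLeftInvariant] [IsTopologicalGroup G]

lemma integral_character_mul_star (ξ η : UnitaryDual n G) [Decidable (ξ = η)] :
    ∫ x, (ξ.rep.toHom x).trace * star (η.rep.toHom x).trace ∂μ = if ξ = η then 1 else 0 := by
  have h : ∫ x, (ξ.rep.toHom x).trace * star (η.rep.toHom x).trace ∂μ =
      ∑ i, ∑ j, ∫ x, ξ.rep.toHom x i i * star (η.rep.toHom x j j) ∂μ := by
    have hint := fun i j => UnitaryIrrep.integrable_coeff_mul μ ξ.rep η.rep i i j j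
    simp only [Matrix.trace, Matrix.diag_apply, star_sum, Finset.sum_mul_sum]
    rw [integral_finsetSum _ fun i _ => integrable_finsetSum _ fun j _ => hint i j]
    exact Finset.sum_congr rfl fun i _ => integral_finsetSum _ fun j _ => hint i j
  rw [h]
  split_ifs with hξη
  · subst hξη
    have hd : (ξ.rep.dim : ℂ) ≠ 0 := by exact_mod_cast ξ.rep.dim_pos.ne'
    simp only [UnitaryIrrep.integral_coeff_self, and_self, Finset.sum_ite_eq, Finset.mem_univ,
      if_true, Finset.sum_const, Finset.card_univ, Fintype.card_fin, nsmul_eq_mul]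
    exact mul_inv_cancel₀ hd
  · refine Finset.sum_eq_zero fun i _ => Finset.sum_eq_zero fun j _ => ?_
    exact UnitaryIrrep.integral_coeff_of_not_equivalent μ (not_equivalent_rep (Ne.symm hξη)) i i j j

lemma integral_norm_sq_sum_character (S : Finset (UnitaryDual n G)) :
    ∫ x, ‖∑ ξ ∈ S, (ξ.rep.toHom x).trace‖ ^ 2 ∂μ = S.card := by
  classical
  apply Complex.ofReal_injective
  rw [← integral_complex_ofReal]
  have h : ∀ x, ((‖∑ ξ ∈ S, (ξ.rep.toHom x).trace‖ ^ 2 : ℝ) : ℂ) =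
      ∑ ξ ∈ S, ∑ η ∈ S, (ξ.rep.toHom x).trace * star (η.rep.toHom x).trace := by
    intro x
    rw [← Finset.sum_mul_sum, ← star_sum, RCLike.star_def, Complex.mul_conj']
    push_cast
    rfl
  simp_rw [h]
  have hint : ∀ ξ η : UnitaryDual n G,
      Integrable (fun x => (ξ.rep.toHom x).trace * star (η.rep.toHom x).trace) μ := fun ξ η =>
    integrable_of_continuous μ (ξ.rep.continuous_trace.mul η.rep.continuous_trace.star)
  rw [integral_finsetSum _ fun i _ => integrable_finsetSum _ fun j _ => hint i j]
  simp_rw [integral_finsetSum _ fun j _ => hint _ j, integral_character_mul_star]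
  simp

/-- On `V` every character has real part at least `d_ξ/2 ≥ 1/2`, so the sum of `N` of them has
modulus at least `N/2`; its squared `L²` norm over `G` is only `N`. -/
lemma card_mul_measure_le {V : Set G} (hV : MeasurableSet V) (S : Finset (UnitaryDual n G))
    (h : ∀ ξ ∈ S, ∀ x ∈ V, ∀ k, ‖ξ.rep.toHom x k k - 1‖ ≤ 1 / 2) :
    S.card * μ.real V ≤ 4 := by
  set N : ℝ := (S.card : ℝ) with hN
  have hcont : Continuous fun x => ∑ ξ ∈ S, (ξ.rep.toHom x).trace :=
    continuous_finsetSum _ fun ξ _ => ξ.rep.continuous_trace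
  have hint : Integrable (fun x => ‖∑ ξ ∈ S, (ξ.rep.toHom x).trace‖ ^ 2) μ :=
    (hcont.norm.pow 2).integrable_of_hasCompactSupport (HasCompactSupport.of_compactSpace _)
  have hlow : ∀ x ∈ V, (N / 2) ^ 2 ≤ ‖∑ ξ ∈ S, (ξ.rep.toHom x).trace‖ ^ 2 := by
    intro x hx
    gcongr
    refine le_trans ?_ (Complex.re_le_norm _)
    rw [Complex.re_sum]
    have h1 : ∀ ξ ∈ S, (1 / 2 : ℝ) ≤ ((ξ.rep.toHom x).trace).re := by
      intro ξ hξ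
      have h2 : ∀ k, (1 / 2 : ℝ) ≤ (ξ.rep.toHom x k k).re := by
        intro k
        have h3 := (Complex.abs_re_le_norm _).trans (h ξ hξ x hx k)
        rw [Complex.sub_re, Complex.one_re] at h3
        linarith [(abs_le.1 h3).1]
      have hd : (1 : ℝ) ≤ ξ.rep.dim := by exact_mod_cast ξ.rep.dim_pos
      rw [Matrix.trace, Complex.re_sum]
      calc (1 / 2 : ℝ) ≤ ξ.rep.dim * (1 / 2) := by linarith
        _ = ∑ k : Fin ξ.rep.dim, (1 / 2 : ℝ) := by simp
        _ ≤ _ := Finset.sum_le_sum fun k _ => h2 k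
    calc N / 2 = ∑ ξ ∈ S, (1 / 2 : ℝ) := by simp [hN, div_eq_mul_inv]
      _ ≤ _ := Finset.sum_le_sum h1
  have hle : (N / 2) ^ 2 * μ.real V ≤ N := by
    calc (N / 2) ^ 2 * μ.real V = ∫ x in V, (N / 2) ^ 2 ∂μ := by
          rw [setIntegral_const, smul_eq_mul, mul_comm]
      _ ≤ ∫ x in V, ‖∑ ξ ∈ S, (ξ.rep.toHom x).trace‖ ^ 2 ∂μ :=
          setIntegral_mono_on integrableOn_const hint.integrableOn hV hlow
      _ ≤ ∫ x, ‖∑ ξ ∈ S, (ξ.rep.toHom x).trace‖ ^ 2 ∂μ :=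
          setIntegral_le_integral hint (Filter.Eventually.of_forall fun x => by positivity)
      _ = N := integral_norm_sq_sum_character μ S
  rcases (Nat.cast_nonneg S.card : (0 : ℝ) ≤ S.card).eq_or_lt with h0 | h0
  · rw [hN, ← h0]; norm_num
  · have : N * (N * μ.real V) ≤ N * 4 := by nlinarith
    exact le_of_mul_le_mul_left this h0

end Finiteness

/-! ### Hilbert–Schmidt norms and frequency truncation -/

lemma hsNorm_eq_norm {d : ℕ} (A : Matrix (Fin d) (Fin d) ℂ) :
    hsNorm A = ‖WithLp.toLp 2 fun p : Fin d × Fin d => A p.1 p.2‖ := by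
  rw [EuclideanSpace.norm_eq, hsNorm, Fintype.sum_prod_type, Matrix.trace, Complex.re_sum]
  congr 1
  refine Finset.sum_congr rfl fun i _ => ?_
  rw [Matrix.diag_apply, Matrix.mul_apply, Complex.re_sum]
  refine Finset.sum_congr rfl fun j _ => ?_
  rw [Matrix.conjTranspose_apply, RCLike.star_def, Complex.mul_conj', ← Complex.ofReal_pow,
    Complex.ofReal_re]

lemma hsNorm_add_le {d : ℕ} (A A' : Matrix (Fin d) (Fin d) ℂ) :
    hsNorm (A + A') ≤ hsNorm A + hsNorm A' := by
  simp only [hsNorm_eq_norm]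
  exact norm_add_le (WithLp.toLp 2 fun p : Fin d × Fin d => A p.1 p.2)
    (WithLp.toLp 2 fun p : Fin d × Fin d => A' p.1 p.2)

lemma hsNorm_zero {d : ℕ} : hsNorm (0 : Matrix (Fin d) (Fin d) ℂ) = 0 := by
  simp [hsNorm]

section Tail

variable {n : ℕ} {G : Type*} [Group G] [TopologicalSpace G]
  [ChartedSpace (EuclideanSpace ℝ (Fin n)) G]

lemma tailSup_add_le (X : Module.Basis (Fin n) ℝ (GroupLieAlgebra (𝓡 n) G))
    (f g : distributions n G) (s : ℕ) : tailSup X (f + g) s ≤ tailSup X f s + tailSup X g s := by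
  refine iSup₂_le fun ξ h => ?_
  have hd : (0 : ℝ) ≤ (ξ.rep.dim : ℝ) ^ (-(1 / 2) : ℝ) := by positivity
  calc ENNReal.ofReal ((ξ.rep.dim : ℝ) ^ (-(1 / 2) : ℝ) *
        hsNorm (groupFourierCoeff (f + g) ξ.rep))
      ≤ ENNReal.ofReal ((ξ.rep.dim : ℝ) ^ (-(1 / 2) : ℝ) * hsNorm (groupFourierCoeff f ξ.rep) +
          (ξ.rep.dim : ℝ) ^ (-(1 / 2) : ℝ) * hsNorm (groupFourierCoeff g ξ.rep)) := by
        refine ENNReal.ofReal_le_ofReal ?_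
        rw [← mul_add, groupFourierCoeff_add]
        exact mul_le_mul_of_nonneg_left (hsNorm_add_le _ _) hd
    _ ≤ _ := ENNReal.ofReal_add_le
    _ ≤ _ := add_le_add
        (le_iSup₂ (f := fun (ξ : UnitaryDual n G) (_ : (2 : ℝ) ^ s ≤ ξ.rep.bracket X) =>
          ENNReal.ofReal ((ξ.rep.dim : ℝ) ^ (-(1 / 2) : ℝ) *
            hsNorm (groupFourierCoeff f ξ.rep))) ξ h)
        (le_iSup₂ (f := fun (ξ : UnitaryDual n G) (_ : (2 : ℝ) ^ s ≤ ξ.rep.bracket X) =>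
          ENNReal.ofReal ((ξ.rep.dim : ℝ) ^ (-(1 / 2) : ℝ) *
            hsNorm (groupFourierCoeff g ξ.rep))) ξ h)

lemma tailSup_le_of_coeff {X : Module.Basis (Fin n) ℝ (GroupLieAlgebra (𝓡 n) G)}
    {f g : distributions n G} {s t : ℕ}
    (h : ∀ ξ : UnitaryDual n G, (2 : ℝ) ^ s ≤ ξ.rep.bracket X → groupFourierCoeff g ξ.rep = 0 ∨
      (groupFourierCoeff g ξ.rep = groupFourierCoeff f ξ.rep ∧ (2 : ℝ) ^ t ≤ ξ.rep.bracket X)) :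
    tailSup X g s ≤ tailSup X f t := by
  refine iSup₂_le fun ξ hξ => ?_
  rcases h ξ hξ with h0 | ⟨h1, h2⟩
  · rw [h0, hsNorm_zero]; simp
  · rw [h1]
    exact le_iSup₂ (f := fun (ξ : UnitaryDual n G) (_ : (2 : ℝ) ^ t ≤ ξ.rep.bracket X) =>
      ENNReal.ofReal ((ξ.rep.dim : ℝ) ^ (-(1 / 2) : ℝ) *
        hsNorm (groupFourierCoeff f ξ.rep))) ξ h2

lemma tailSup_eq_zero {X : Module.Basis (Fin n) ℝ (GroupLieAlgebra (𝓡 n) G)}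
    {f : distributions n G} {s : ℕ}
    (h : ∀ ξ : UnitaryDual n G, (2 : ℝ) ^ s ≤ ξ.rep.bracket X → groupFourierCoeff f ξ.rep = 0) :
    tailSup X f s = 0 := by
  rw [← nonpos_iff_eq_zero]
  refine iSup₂_le fun ξ hξ => ?_
  rw [h ξ hξ, hsNorm_zero]; simp

/-- With exponent `1/r` the weight `2^(r n s)` becomes `2^(n s)`. -/
lemma beurlingStarNorm_eq_beurlingNorm (X : Module.Basis (Fin n) ℝ (GroupLieAlgebra (𝓡 n) G))
    {r : ℝ} (hr : 0 < r) :
    (beurlingStarNorm X (1 / r) : distributions n G → ℝ≥0∞) =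
      beurlingNorm X r (ENNReal.ofReal (1 / r)) := by
  ext f
  have hr' : 0 < 1 / r := by positivity
  rw [beurlingStarNorm, beurlingNorm, lqNorm_of_ne_top ENNReal.ofReal_ne_top,
    ENNReal.toReal_ofReal hr'.le]
  congr 1
  refine tsum_congr fun s => ?_
  rw [ofReal_two_rpow, ENNReal.mul_rpow_of_nonneg _ _ hr'.le, ← ENNReal.rpow_mul,
    ← ENNReal.rpow_natCast]
  congr 2
  push_cast
  field_simp

variable [LieGroup (𝓡 n) ∞ G]

/-- In dimension zero all tails of positive index vanish, so the weight exponent is irrelevant. -/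
lemma beurlingNorm_eq_tailNorm (B : InvariantInnerProduct n G)
    (X : Module.Basis (Fin n) ℝ (GroupLieAlgebra (𝓡 n) G)) (hX : B.IsOrthonormalBasis X)
    (r : ℝ) (β : ℝ≥0∞) :
    (beurlingNorm X r β : distributions n G → ℝ≥0∞) =
      tailNorm (tailSup X) (r * (max n 1 : ℕ)) β := by
  ext f
  rw [beurlingNorm, tailNorm]
  congr 1
  ext s
  rw [ofReal_two_rpow]
  rcases Nat.eq_zero_or_pos n with hn | hn
  · subst hn
    rcases Nat.eq_zero_or_pos s with hs | hs
    · simp [hs]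
    · rw [tailSup_eq_zero, mul_zero, mul_zero]
      intro ξ hξ
      rw [UnitaryIrrep.bracket_eq_one_of_dim_zero _ B X hX] at hξ
      exact absurd hξ (not_le.2 (one_lt_pow₀ one_lt_two hs.ne'))
  · rw [max_eq_left hn]

variable [CompactSpace G]

/-- The Laplacian has only finitely many irreducible representations below a given eigenvalue. -/
lemma finite_bracket_le (B : InvariantInnerProduct n G)
    (X : Module.Basis (Fin n) ℝ (GroupLieAlgebra (𝓡 n) G)) (hX : B.IsOrthonormalBasis X)
    (R : ℝ) : {ξ : UnitaryDual n G | ξ.rep.bracket X ≤ R}.Finite := by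
  have : IsTopologicalGroup G := topologicalGroup_of_lieGroup (𝓡 n) ∞
  let _ : MeasurableSpace G := borel G
  have : BorelSpace G := ⟨rfl⟩
  obtain ⟨μ, h1, h2, h3⟩ := exists_leftInvariant_probability (G := G)
  obtain ⟨U, hU, hle⟩ := UnitaryIrrep.exists_nhds_one_norm_sub_one_le B X hX R
  obtain ⟨V, hVU, hVo, hV1⟩ := mem_nhds_iff.1 hU
  have hpos : 0 < μ.real V :=
    ENNReal.toReal_pos (hVo.measure_pos μ ⟨1, hV1⟩).ne' (measure_ne_top μ V)
  by_contra hinf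
  obtain ⟨N, hN⟩ := exists_nat_gt (4 / μ.real V)
  obtain ⟨S, hS, hcard⟩ := Set.Infinite.exists_subset_card_eq hinf N
  have h4 := card_mul_measure_le μ hVo.measurableSet S fun ξ hξ x hx k =>
    hle ξ.rep (hS hξ) x (hVU hx) k
  rw [hcard] at h4
  rw [div_lt_iff₀ hpos] at hN
  linarith

/-- The low-frequency part keeps the coefficients of the finitely many classes with `⟨ξ⟩ < 2^m`. The
remainder lives on `⟨ξ⟩ ≥ 2^m`, so its tail at `j` only sees levels from `max j m` on. -/
lemma isTailFunctional_tailSup (B : InvariantInnerProduct n G)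
    (X : Module.Basis (Fin n) ℝ (GroupLieAlgebra (𝓡 n) G)) (hX : B.IsOrthonormalBasis X) :
    IsTailFunctional (tailSup X : distributions n G → ℕ → ℝ≥0∞) where
  add_le := tailSup_add_le X
  split f m := by
    have : IsTopologicalGroup G := topologicalGroup_of_lieGroup (𝓡 n) ∞
    have hfin : {ξ : UnitaryDual n G | ξ.rep.bracket X < 2 ^ m}.Finite :=
      (finite_bracket_le B X hX (2 ^ m)).subset (Set.ofPred_subset_ofPred.2 fun ξ => le_of_lt)
    obtain ⟨g, hg, hg'⟩ := exists_groupFourierCoeff_eq_on_finset hfin.toFinset f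
    simp only [Set.Finite.mem_toFinset, Set.mem_ofPred_eq, not_lt] at hg hg'
    refine ⟨g, f - g, add_sub_cancel g f, fun j hj => ?_, fun j hj => ?_, fun j => ?_⟩
    · refine tailSup_le_of_coeff fun ξ hξ => ?_
      rcases lt_or_ge (ξ.rep.bracket X) (2 ^ m) with h | h
      · exact Or.inr ⟨hg ξ h, hξ⟩
      · exact Or.inl (hg' ξ h)
    · exact tailSup_eq_zero fun ξ hξ => hg' ξ ((pow_le_pow_right₀ one_le_two hj).trans hξ)
    · refine tailSup_le_of_coeff fun ξ hξ => ?_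
      rcases lt_or_ge (ξ.rep.bracket X) (2 ^ m) with h | h
      · left
        rw [groupFourierCoeff_sub, hg ξ h, sub_self]
      · right
        refine ⟨by rw [groupFourierCoeff_sub, hg' ξ h, sub_zero], ?_⟩
        rcases max_choice j m with hm | hm <;> rw [hm] <;> assumption

end Tail

end BeurlingLie

end

/-! ### Interpolation of the Beurling spaces -/

theorem theorem4 {n : ℕ} {G : Type*} [Group G] [TopologicalSpace G]
    [ChartedSpace (EuclideanSpace ℝ (Fin n)) G] [LieGroup (𝓡 n) ∞ G] [CompactSpace G] [T2Space G]
    (B : BeurlingLie.InvariantInnerProduct n G)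
    (X : Module.Basis (Fin n) ℝ (GroupLieAlgebra (𝓡 n) G)) (hX : B.IsOrthonormalBasis X)
    (r₀ r₁ r θ : ℝ) (hr₁ : 0 < r₁) (hr₀ : r₁ < r₀) (hθ₀ : 0 < θ) (hθ₁ : θ < 1)
    (hr : r = (1 - θ) * r₀ + θ * r₁) :
    (∀ β₀ β₁ q : ℝ≥0∞, 0 < β₀ → 0 < β₁ → 0 < q →
      BeurlingLie.interpSpace (BeurlingLie.beurlingNorm X r₀ β₀)
          (BeurlingLie.beurlingNorm X r₁ β₁) θ q =
        BeurlingLie.finiteSet (BeurlingLie.beurlingNorm X r q) ∧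
      BeurlingLie.EquivalentNorms
        (BeurlingLie.interpNorm (BeurlingLie.beurlingNorm X r₀ β₀)
          (BeurlingLie.beurlingNorm X r₁ β₁) θ q)
        (BeurlingLie.beurlingNorm X r q)) ∧
    BeurlingLie.interpSpace (BeurlingLie.beurlingStarNorm X (1 / r₀))
        (BeurlingLie.beurlingStarNorm X (1 / r₁)) θ (ENNReal.ofReal (1 / r)) =
      BeurlingLie.finiteSet (BeurlingLie.beurlingStarNorm X (1 / r)) ∧
    BeurlingLie.EquivalentNorms
      (BeurlingLie.interpNorm (BeurlingLie.beurlingStarNorm X (1 / r₀))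
        (BeurlingLie.beurlingStarNorm X (1 / r₁)) θ (ENNReal.ofReal (1 / r)))
      (BeurlingLie.beurlingStarNorm X (1 / r)) := by
  have main : ∀ β₀ β₁ q : ℝ≥0∞, 0 < β₀ → 0 < β₁ → 0 < q →
      BeurlingLie.interpSpace (BeurlingLie.beurlingNorm X r₀ β₀)
          (BeurlingLie.beurlingNorm X r₁ β₁) θ q =
        BeurlingLie.finiteSet (BeurlingLie.beurlingNorm X r q) ∧
      BeurlingLie.EquivalentNorms
        (BeurlingLie.interpNorm (BeurlingLie.beurlingNorm X r₀ β₀)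
          (BeurlingLie.beurlingNorm X r₁ β₁) θ q)
        (BeurlingLie.beurlingNorm X r q) := by
    intro β₀ β₁ q hβ₀ hβ₁ hq
    -- Replacing `n` by `max n 1` in the weights keeps the lower exponent positive when `n = 0`, and
    -- scaling all three exponents preserves their convex relation.
    have hN : (0 : ℝ) < (max n 1 : ℕ) := by positivity
    simp only [BeurlingLie.beurlingNorm_eq_tailNorm B X hX]
    exact (BeurlingLie.isTailFunctional_tailSup B X hX).interpolation (mul_pos hr₁ hN)
      (mul_lt_mul_of_pos_right hr₀ hN) hθ₀ hθ₁ (by rw [hr]; ring) hβ₀ hβ₁ hq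
  have hr₀' : 0 < r₀ := hr₁.trans hr₀
  have hr' : 0 < r := by
    rw [hr]
    exact add_pos (mul_pos (sub_pos.2 hθ₁) hr₀') (mul_pos hθ₀ hr₁)
  have hpos : ∀ {u : ℝ}, 0 < u → 0 < ENNReal.ofReal (1 / u) := fun hu =>
    ENNReal.ofReal_pos.2 (one_div_pos.2 hu)
  refine ⟨main, ?_⟩
  rw [BeurlingLie.beurlingStarNorm_eq_beurlingNorm X hr₀',
    BeurlingLie.beurlingStarNorm_eq_beurlingNorm X hr₁,
    BeurlingLie.beurlingStarNorm_eq_beurlingNorm X hr']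
  exact main _ _ _ (hpos hr₀') (hpos hr₁) (hpos hr')
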